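/- **Setting.** Equip $\mathbb{R}^{d\times r}$ with $\langle A,B\rangle=\mathrm{Tr}(AB^\top)$ and the Frobenius norm $\|\cdot\|$; write $\mathrm{skew}(A)=\frac12(A-A^\top)$, $\mathrm{sym}(A)=\frac12(A+A^\top)$. Let $\mathrm{St}(d,r)=\{x: x^\top x=I_r\}$ and, for $\epsilon\in(0,\frac34)$, $\mathrm{St}(d,r)^\epsilon=\{x:\|x^\top x-I_r\|\le\epsilon\}$. For a set $\mathcal S$ let $\mathcal D(\mathcal S,a)=\{x:\mathrm{dist}(\mathcal S,x)\le a\}$ (empty if $\mathcal S=\emptyset$). Let $f:\mathbb{R}^{d\times r}\to\mathbb{R}$ be twice continuously differentiable and $L$-smooth, i.e. $\nabla f$ is $L$-Lipschitz on $\mathbb{R}^{d\times r}$. Put $\mathrm{grad}f(x)=\mathrm{skew}(\nabla f(x)x^\top)x$. Let $f^*_{\mathcal S}\in\mathbb{R}$, let $\mathcal S$ be the set of all local minima of $f|_{\mathrm{St}(d,r)}$ with value $f^*_{\mathcal S}$, and let $\mu,\delta>0$ be such that the local Riemannian PŁ condition $$|f(x)-f^*_{\mathcal S}|\le\tfrac1{2\mu}\|\mathrm{grad}f(x)\|^2\qquad\text{for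 all }x\in\mathrm{St}(d,r)\cap\mathcal D(\mathcal S,2\delta)$$ holds. Let $\lambda>0$, $p(x)=\frac14\|x^\top x-I_r\|^2$, $\Lambda(x)=\mathrm{grad}f(x)+\lambda x(x^\top x-I_r)$, and $$\mathcal L(x)=f(x)-f^*_{\mathcal S}-\tfrac12\langle\mathrm{sym}(x^\top\nabla f(x)),x^\top x-I_r\rangle+\gamma p(x),$$ where $$\gamma\ge\frac{2}{3-4\epsilon}\Big(L(1-\epsilon)+3s+\hat L^2\frac{(1+\epsilon)^2}{\lambda(1-\epsilon)}\Big),\quad s=\sup_{x\in\mathrm{St}(d,r)^\epsilon}\|\mathrm{sym}(x^\top\nabla f(x))\|,\quad \hat L=\max\Big(L,\max_{x\in\mathrm{St}(d,r)^\epsilon}\|\nabla f(x)\|\Big).$$ Let $L_\Lambda$ be a Lipschitz constant of $\Lambda$ on $\mathrm{St}(d,r)^\epsilon$, and let $L_{\mathcal L}$ be a constant such that $\mathcal L$ is $L_{\mathcal L}$-smooth on $\mathrm{St}(d,r)^\epsilon$, i.e. $\mathcal L(y)\le\mathcal L(x)+\langle\nabla\mathcal L(x),y-x\rangle+\frac{L_{\mathcal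 L}}2\|y-x\|^2$ whenever the segment $[x,y]$ lies in $\mathrm{St}(d,r)^\epsilon$. Put $$L'=\max\{\hat L,L_\Lambda,L_{\mathcal L}\},\qquad \rho=\min\Big\{\frac12,\frac{\gamma}{4\lambda(1+\epsilon)}\Big\},\qquad \frac1{\mu'}=\max\Big\{\frac1\mu,\frac{2(3+2\epsilon)^2\hat L^2+\mu L'}{2\mu\lambda^2(1-\epsilon)^2}\Big\}.$$ Let $x_{k+1}=x_k-\alpha\Lambda(x_k)$ for $k\ge0$, let $G>0$ satisfy $\|\mathrm{grad}f(x_k)\|\le G$ for every iterate $x_k$ lying in $\mathrm{St}(d,r)^\epsilon$, and put $$\alpha_{safe}=\min\Big\{\frac{\lambda\epsilon(1-\epsilon)}{G^2+\lambda^2(1+\epsilon)\epsilon^2},\sqrt{\frac{\epsilon}{2G^2}},\frac1{2\lambda}\Big\}.$$ **Theorem 1.** Suppose that $x_0\in\mathcal D(\mathcal S,\delta)\cap\mathrm{St}(d,r)^\epsilon$, $\mathcal L(x_0)\le\frac{\mu'\rho^2\delta^2}{16}$ and $0<\alpha\le\min\{\frac{\rho}{L'},\alpha_{safe}\}$. Then,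 for all $k\ge0$, $$x_k\in\mathrm{St}(d,r)^\epsilon\qquad\text{and}\qquad\mathcal L(x_k)\le\Big(1-\frac{\alpha\rho\mu'}2\Big)^k\mathcal L(x_0).$$ If moreover $f\ge f^*_{\mathcal S}$ on $\mathrm{St}(d,r)\cap\mathcal D(\mathcal S,2\delta)$, then also $x_k\in\mathcal D(\mathcal S,\delta)$ for all $k\ge0$. -/

import Mathlib

open scoped Matrix Matrix.Norms.Frobenius Gradient RealInnerProductSpace NNReal

noncomputable section

namespace Landing

variable {d r : ℕ}

/-- The inner product `⟨A, B⟩ = Tr (A Bᵀ)` on `ℝ^{d×r}`; it induces the Frobenius norm. -/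
instance frobeniusInnerProductSpace : InnerProductSpace ℝ (Matrix (Fin d) (Fin r) ℝ) where
  toNormedSpace := Matrix.frobeniusNormedSpace
  inner A B := (A * Bᵀ).trace
  norm_sq_eq_re_inner A := by
    rw [Matrix.frobenius_norm_def, ← Real.sqrt_eq_rpow, Real.sq_sqrt (by positivity)]
    simp [Matrix.trace, Matrix.mul_apply, pow_two]
  conj_inner_symm A B := by
    change (B * Aᵀ).trace = (A * Bᵀ).trace
    rw [← Matrix.trace_transpose, Matrix.transpose_mul, Matrix.transpose_transpose]
  add_left A B C := by
    change ((A + B) * Cᵀ).trace = (A * Cᵀ).trace + (B * Cᵀ).trace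
    rw [Matrix.add_mul, Matrix.trace_add]
  smul_left A B c := by
    change ((c • A) * Bᵀ).trace = c * (A * Bᵀ).trace
    rw [Matrix.smul_mul, Matrix.trace_smul, smul_eq_mul]

/-- The skew-symmetric part of a square matrix. -/
def skewPart {n : ℕ} (A : Matrix (Fin n) (Fin n) ℝ) : Matrix (Fin n) (Fin n) ℝ :=
  (1 / 2 : ℝ) • (A - Aᵀ)

/-- The symmetric part of a square matrix. -/
def symPart {n : ℕ} (A : Matrix (Fin n) (Fin n) ℝ) : Matrix (Fin n) (Fin n) ℝ :=
  (1 / 2 : ℝ) • (A + Aᵀ)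

/-- The Stiefel manifold `St(d, r)`. -/
def stiefel (d r : ℕ) : Set (Matrix (Fin d) (Fin r) ℝ) :=
  {x | xᵀ * x = 1}

/-- The safety region `St(d, r)^ε`. -/
def safeRegion (d r : ℕ) (ε : ℝ) : Set (Matrix (Fin d) (Fin r) ℝ) :=
  {x | ‖xᵀ * x - 1‖ ≤ ε}

/-- The Riemannian (off the manifold: relative) gradient `skew(∇f(x) xᵀ) x`. -/
def relGrad (f : Matrix (Fin d) (Fin r) ℝ → ℝ) (x : Matrix (Fin d) (Fin r) ℝ) :
    Matrix (Fin d) (Fin r) ℝ :=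
  skewPart (∇ f x * xᵀ) * x

/-- The penalty `p(x) = ‖xᵀx - I‖² / 4`. -/
def penalty (x : Matrix (Fin d) (Fin r) ℝ) : ℝ :=
  1 / 4 * ‖xᵀ * x - 1‖ ^ 2

/-- The landing field `Λ(x) = grad f(x) + lam ∇p(x)`, where `∇p(x) = x (xᵀx - I)`. -/
def landingField (f : Matrix (Fin d) (Fin r) ℝ → ℝ) (lam : ℝ)
    (x : Matrix (Fin d) (Fin r) ℝ) : Matrix (Fin d) (Fin r) ℝ :=
  relGrad f x + lam • (x * (xᵀ * x - 1))

/-- `x 0, x 1, …` are the iterates of the landing algorithm with step size `α`. -/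
def IsLandingSequence (f : Matrix (Fin d) (Fin r) ℝ → ℝ) (lam α : ℝ)
    (x : ℕ → Matrix (Fin d) (Fin r) ℝ) : Prop :=
  ∀ k, x (k + 1) = x k - α • landingField f lam (x k)

/-- The set of all local minima, with value `c`, of `f` restricted to the Stiefel manifold. -/
def localMinima (f : Matrix (Fin d) (Fin r) ℝ → ℝ) (c : ℝ) : Set (Matrix (Fin d) (Fin r) ℝ) :=
  {x | x ∈ stiefel d r ∧ IsLocalMinOn f (stiefel d r) x ∧ f x = c}

/-- `f` is twice continuously differentiable and `L`-smooth on the whole space. -/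
def IsSmoothObjective (f : Matrix (Fin d) (Fin r) ℝ → ℝ) (L : ℝ≥0) : Prop :=
  ContDiff ℝ 2 f ∧ LipschitzWith L (∇ f)

/-- The local Riemannian Polyak-Łojasiewicz condition with factor `μ` around the local minima of
value `c`. `Metric.cthickening a S` is `{x | dist(S, x) ≤ a}` (empty if `S` is). -/
def LocalRiemannianPL (f : Matrix (Fin d) (Fin r) ℝ → ℝ) (c μ δ : ℝ) : Prop :=
  ∀ x ∈ stiefel d r ∩ Metric.cthickening (2 * δ) (localMinima f c),
    |f x - c| ≤ 1 / (2 * μ) * ‖relGrad f x‖ ^ 2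

/-- The term `h(x) = -⟨sym(xᵀ∇f(x)), xᵀx - I⟩ / 2` of the merit function. -/
def meritCorrection (f : Matrix (Fin d) (Fin r) ℝ → ℝ) (x : Matrix (Fin d) (Fin r) ℝ) : ℝ :=
  -(1 / 2) * ⟪symPart (xᵀ * ∇ f x), xᵀ * x - 1⟫

/-- The merit function `f + h + γ p`. -/
def merit (f : Matrix (Fin d) (Fin r) ℝ → ℝ) (γ : ℝ) (x : Matrix (Fin d) (Fin r) ℝ) : ℝ :=
  f x + meritCorrection f x + γ * penalty x

/-- `F` is `K`-smooth on the (in general non-convex) set `s`: the quadratic upper bound holds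
along every line segment that lies in `s`. -/
def SmoothOn (F : Matrix (Fin d) (Fin r) ℝ → ℝ) (K : ℝ) (s : Set (Matrix (Fin d) (Fin r) ℝ)) :
    Prop :=
  ∀ x y, segment ℝ x y ⊆ s → F y ≤ F x + ⟪∇ F x, y - x⟫ + K / 2 * ‖y - x‖ ^ 2

/-- `s = sup ‖sym(xᵀ∇f(x))‖` over the safety region. -/
def symSup (f : Matrix (Fin d) (Fin r) ℝ → ℝ) (ε : ℝ) : ℝ :=
  sSup ((fun x => ‖symPart (xᵀ * ∇ f x)‖) '' safeRegion d r ε)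

/-- `L̂ = max (L, max ‖∇f(x)‖)`, the inner maximum over the safety region. -/
def Lhat (f : Matrix (Fin d) (Fin r) ℝ → ℝ) (L ε : ℝ) : ℝ :=
  max L (sSup ((fun x => ‖∇ f x‖) '' safeRegion d r ε))

/-- The lower bound on the merit parameter `γ`. -/
def gammaMin (f : Matrix (Fin d) (Fin r) ℝ → ℝ) (L ε lam : ℝ) : ℝ :=
  2 / (3 - 4 * ε) * (L * (1 - ε) + 3 * symSup f ε
    + Lhat f L ε ^ 2 * ((1 + ε) ^ 2 / (lam * (1 - ε))))

/-- `ρ = min {1/2, γ / (4 lam (1 + ε))}`. -/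
def rho (γ lam ε : ℝ) : ℝ :=
  min (1 / 2) (γ / (4 * lam * (1 + ε)))

/-- The constant `μ'`, where `L'` is `Lp`, and `L̂` is `Lh`. -/
def muPrime (μ lam ε Lh Lp : ℝ) : ℝ :=
  1 / max (1 / μ) ((2 * (3 + 2 * ε) ^ 2 * Lh ^ 2 + μ * Lp) / (2 * μ * lam ^ 2 * (1 - ε) ^ 2))

/-- The safety step size. -/
def alphaSafe (lam ε G : ℝ) : ℝ :=
  min (lam * ε * (1 - ε) / (G ^ 2 + lam ^ 2 * (1 + ε) * ε ^ 2))
    (min (√(ε / (2 * G ^ 2))) (1 / (2 * lam)))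

end Landing

end

open Landing

/-! Write `u` for the merit function minus `fS`, `D = xᵀx - 1` and `n = ‖D‖`. The proof is a
Łojasiewicz finite-length argument for `u` along the landing iterates.

Descent: the two parts of the landing field `Λ` are orthogonal, and the correction term of the merit
function cancels the first-order coupling between them. The choice of `γ` absorbs what remains, so
`⟨∇u, Λ⟩ ≥ ρ‖Λ‖²` (`rho_mul_norm_landingField_sq_le`). A step of length `t ≤ α` stays in the safety
region and lowers `u` by at least `tρ/2 ‖Λ‖²` (`merit_landing_step_le`).

Gradient domination: `x` is compared with its polar factor `y` on the Stiefel manifold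
(`exists_stiefel_comparison`). The merit gradient at `y` vanishes in normal directions, so `u(x)`
exceeds `f(y) - fS` by `O(n²)` only. The PŁ inequality at `y` then gives `μ' u ≤ κ(n)² ‖Λ‖²` with `κ
= pathFactor` (`muPrime_mul_merit_le`), as long as `y` is within `2δ` of the minima.

Tracking: together these bound step lengths by `κ · 4/(ρ√μ')` times the decrease of `√u`
(`step_length_le`), and the hypothesis on the initial point makes the total at most `κδ`. So `x` is
within `(1 + κ)δ` of the minima. Passing to `y` may expand distances by `(1 - n)^(-1/4)`, so a
constant factor `κ = 1` would not suffice; the factor is chosen with `(1 + κ(n))² < 4√(1 - n)`.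
Since `max n (1/4)` never increases along the iteration, `κ` never decreases, and the length bound
can be carried along with the current `κ`.

While `u ≥ 0` this yields the contraction; once `u < 0`, monotonicity is enough. If `f ≥ fS` near
the minima, then `u ≥ 0` near them, because `f(y)` is at most the merit value at `x`. Closeness and
nonnegativity depend on each other, and a continuity argument along each step separates them. The
iterates then converge to a point of the minimum set at distance at most `67/80 · δ` from every
iterate. -/

namespace Landing

/-! ### Frobenius inner product, symmetric and skew parts. -/

section FrobeniusInner

variable {k l m : ℕ}

theorem inner_eq_trace (A B : Matrix (Fin k) (Fin l) ℝ) : ⟪A, B⟫ = (A * Bᵀ).trace := rfl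

theorem inner_transpose (A B : Matrix (Fin k) (Fin l) ℝ) : ⟪Aᵀ, Bᵀ⟫ = ⟪A, B⟫ := by
  rw [inner_eq_trace, inner_eq_trace, Matrix.transpose_transpose, Matrix.trace_mul_comm,
    ← Matrix.trace_transpose, Matrix.transpose_mul, Matrix.transpose_transpose]

theorem inner_mul_left_eq (A : Matrix (Fin k) (Fin l) ℝ) (B : Matrix (Fin l) (Fin m) ℝ)
    (C : Matrix (Fin k) (Fin m) ℝ) : ⟪A * B, C⟫ = ⟪B, Aᵀ * C⟫ := by
  simp only [inner_eq_trace, Matrix.transpose_mul, Matrix.transpose_transpose]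
  rw [Matrix.mul_assoc, Matrix.trace_mul_comm, Matrix.mul_assoc]

theorem inner_mul_right_eq (A : Matrix (Fin k) (Fin l) ℝ) (B : Matrix (Fin l) (Fin m) ℝ)
    (C : Matrix (Fin k) (Fin m) ℝ) : ⟪A * B, C⟫ = ⟪A, C * Bᵀ⟫ := by
  simp only [inner_eq_trace, Matrix.transpose_mul, Matrix.transpose_transpose, Matrix.mul_assoc]

theorem inner_eq_zero_of_symm_skew {A B : Matrix (Fin k) (Fin k) ℝ} (hA : Aᵀ = A) (hB : Bᵀ = -B) :
    ⟪A, B⟫ = 0 := by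
  have h := inner_transpose A B
  rw [hA, hB, inner_neg_right] at h
  linarith

theorem symPart_transpose (A : Matrix (Fin k) (Fin k) ℝ) : (symPart A)ᵀ = symPart A := by
  simp [symPart, add_comm]

theorem skewPart_transpose (A : Matrix (Fin k) (Fin k) ℝ) : (skewPart A)ᵀ = -skewPart A := by
  simp [skewPart, ← smul_neg]

theorem symPart_add_skewPart (A : Matrix (Fin k) (Fin k) ℝ) : symPart A + skewPart A = A := by
  rw [symPart, skewPart, ← smul_add, add_add_sub_cancel, ← two_smul ℝ A, smul_smul]
  norm_num

theorem inner_symPart (A : Matrix (Fin k) (Fin k) ℝ) {B : Matrix (Fin k) (Fin k) ℝ} (hB : Bᵀ = B) :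
    ⟪symPart A, B⟫ = ⟪A, B⟫ := by
  conv_rhs => rw [← symPart_add_skewPart A]
  rw [inner_add_left, real_inner_comm B (skewPart A),
    inner_eq_zero_of_symm_skew hB (skewPart_transpose A), add_zero]

theorem inner_skewPart (A : Matrix (Fin k) (Fin k) ℝ) {B : Matrix (Fin k) (Fin k) ℝ}
    (hB : Bᵀ = -B) : ⟪A, B⟫ = ⟪skewPart A, B⟫ := by
  conv_lhs => rw [← symPart_add_skewPart A]
  rw [inner_add_left, inner_eq_zero_of_symm_skew (symPart_transpose A) hB, zero_add]

theorem norm_skewPart_le (A : Matrix (Fin k) (Fin k) ℝ) : ‖skewPart A‖ ≤ ‖A‖ := by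
  rw [skewPart, norm_smul]
  have := norm_sub_le A Aᵀ
  rw [Matrix.frobenius_norm_transpose] at this
  norm_num
  linarith

theorem norm_symPart_le (A : Matrix (Fin k) (Fin k) ℝ) : ‖symPart A‖ ≤ ‖A‖ := by
  rw [symPart, norm_smul]
  have := norm_add_le A Aᵀ
  rw [Matrix.frobenius_norm_transpose] at this
  norm_num
  linarith

end FrobeniusInner

/-! ### Multiplication by a nearly orthonormal matrix. -/

section Gram

variable {d r m : ℕ} (x : Matrix (Fin d) (Fin r) ℝ)

theorem gram_sub_one_transpose : (xᵀ * x - 1)ᵀ = xᵀ * x - 1 := by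
  simp

/-- Expanding with `xᵀx = 1 + D`. This identity takes the place of singular value bounds on `x` in
all estimates that follow. -/
theorem norm_mul_sq_sub (A : Matrix (Fin r) (Fin m) ℝ) :
    ‖x * A‖ ^ 2 = ‖A‖ ^ 2 + ⟪A, (xᵀ * x - 1) * A⟫ := by
  rw [← real_inner_self_eq_norm_sq, ← real_inner_self_eq_norm_sq, inner_mul_left_eq,
    ← inner_add_right]
  congr 1
  rw [Matrix.sub_mul, Matrix.mul_assoc, Matrix.one_mul]
  abel

theorem abs_inner_mul_le (D : Matrix (Fin r) (Fin r) ℝ) (A : Matrix (Fin r) (Fin m) ℝ) :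
    |⟪A, D * A⟫| ≤ ‖D‖ * ‖A‖ ^ 2 := by
  refine (abs_real_inner_le_norm _ _).trans ?_
  have := mul_le_mul_of_nonneg_left (Matrix.frobenius_norm_mul D A) (norm_nonneg A)
  linarith [pow_two ‖A‖]

theorem norm_mul_sq_le {n : ℝ} (hn : ‖xᵀ * x - 1‖ ≤ n) (A : Matrix (Fin r) (Fin m) ℝ) :
    ‖x * A‖ ^ 2 ≤ (1 + n) * ‖A‖ ^ 2 := by
  have h := (abs_le.1 (abs_inner_mul_le (xᵀ * x - 1) A)).2
  have := mul_le_mul_of_nonneg_right hn (sq_nonneg ‖A‖)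
  rw [norm_mul_sq_sub]
  linarith

theorem le_norm_mul_sq {n : ℝ} (hn : ‖xᵀ * x - 1‖ ≤ n) (A : Matrix (Fin r) (Fin m) ℝ) :
    (1 - n) * ‖A‖ ^ 2 ≤ ‖x * A‖ ^ 2 := by
  have h := (abs_le.1 (abs_inner_mul_le (xᵀ * x - 1) A)).1
  have := mul_le_mul_of_nonneg_right hn (sq_nonneg ‖A‖)
  rw [norm_mul_sq_sub]
  linarith

theorem norm_mul_le_sqrt {n : ℝ} (hn : ‖xᵀ * x - 1‖ ≤ n) (A : Matrix (Fin r) (Fin m) ℝ) :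
    ‖x * A‖ ≤ √(1 + n) * ‖A‖ := by
  have h0 : 0 ≤ 1 + n := by linarith [norm_nonneg (xᵀ * x - 1)]
  refine le_of_sq_le_sq ?_ (by positivity)
  rw [mul_pow, Real.sq_sqrt h0]
  exact norm_mul_sq_le x hn A

theorem norm_transpose_mul_le_sqrt {n : ℝ} (hn : ‖xᵀ * x - 1‖ ≤ n) (B : Matrix (Fin d) (Fin m) ℝ) :
    ‖xᵀ * B‖ ≤ √(1 + n) * ‖B‖ := by
  rcases (norm_nonneg (xᵀ * B)).eq_or_lt with h | h
  · rw [← h]; positivity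
  · have h1 : ‖xᵀ * B‖ ^ 2 ≤ ‖B‖ * (√(1 + n) * ‖xᵀ * B‖) := by
      rw [← real_inner_self_eq_norm_sq, inner_mul_left_eq, Matrix.transpose_transpose]
      exact (real_inner_le_norm _ _).trans
        (mul_le_mul_of_nonneg_left (norm_mul_le_sqrt x hn _) (norm_nonneg _))
    refine le_of_mul_le_mul_right ?_ h
    linarith [pow_two ‖xᵀ * B‖]

theorem norm_mul_base_le_sqrt {n : ℝ} (hn : ‖xᵀ * x - 1‖ ≤ n) (B : Matrix (Fin m) (Fin d) ℝ) :
    ‖B * x‖ ≤ √(1 + n) * ‖B‖ := by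
  have := norm_transpose_mul_le_sqrt x hn Bᵀ
  rwa [← Matrix.transpose_mul, Matrix.frobenius_norm_transpose, Matrix.frobenius_norm_transpose]
    at this

theorem norm_mul_transpose_le_sqrt {n : ℝ} (hn : ‖xᵀ * x - 1‖ ≤ n) (B : Matrix (Fin m) (Fin r) ℝ) :
    ‖B * xᵀ‖ ≤ √(1 + n) * ‖B‖ := by
  have := norm_mul_le_sqrt x hn Bᵀ
  rwa [← Matrix.frobenius_norm_transpose, Matrix.transpose_mul, Matrix.frobenius_norm_transpose,
    Matrix.transpose_transpose] at this

end Gram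

/-! ### Functional calculus for a symmetric matrix, through one fixed diagonalization. -/

section Spectral

variable {d r : ℕ}

theorem exists_eq_mul_diagonal_mul {A : Matrix (Fin r) (Fin r) ℝ} (hA : Aᵀ = A) :
    ∃ (U : Matrix (Fin r) (Fin r) ℝ) (w : Fin r → ℝ), Uᵀ * U = 1 ∧ U * Uᵀ = 1 ∧
      A = U * Matrix.diagonal w * Uᵀ := by
  have hA' : A.IsHermitian := by rw [Matrix.IsHermitian, Matrix.conjTranspose_eq_transpose_of_trivial, hA]
  have hU := hA'.eigenvectorUnitary.2
  rw [Matrix.mem_unitaryGroup_iff, Matrix.star_eq_conjTranspose,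
    Matrix.conjTranspose_eq_transpose_of_trivial] at hU
  refine ⟨hA'.eigenvectorUnitary, hA'.eigenvalues, ?_, hU, ?_⟩
  · exact mul_eq_one_comm.1 hU
  · have := hA'.spectral_theorem
    rw [Unitary.conjStarAlgAut_apply, Matrix.star_eq_conjTranspose,
      Matrix.conjTranspose_eq_transpose_of_trivial] at this
    exact this

theorem norm_diagonal_sq (w : Fin r → ℝ) : ‖Matrix.diagonal w‖ ^ 2 = ∑ i, w i ^ 2 := by
  rw [Matrix.frobenius_norm_diagonal, EuclideanSpace.norm_sq_eq]
  simp

variable {U : Matrix (Fin r) (Fin r) ℝ}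

theorem norm_conj_diagonal_sq (hU : Uᵀ * U = 1) (w : Fin r → ℝ) :
    ‖U * Matrix.diagonal w * Uᵀ‖ ^ 2 = ∑ i, w i ^ 2 := by
  rw [← norm_diagonal_sq, ← real_inner_self_eq_norm_sq, inner_mul_right_eq, inner_mul_left_eq,
    ← real_inner_self_eq_norm_sq, Matrix.transpose_transpose]
  congr 1
  rw [Matrix.mul_assoc _ _ Uᵀ, Matrix.mul_assoc, Matrix.mul_assoc, hU, Matrix.mul_one,
    ← Matrix.mul_assoc, hU, Matrix.one_mul]

theorem norm_conj_diagonal_le (hU : Uᵀ * U = 1) {w v : Fin r → ℝ} {c : ℝ} (hc : 0 ≤ c)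
    (h : ∀ i, |w i| ≤ c * |v i|) :
    ‖U * Matrix.diagonal w * Uᵀ‖ ≤ c * ‖U * Matrix.diagonal v * Uᵀ‖ := by
  refine le_of_sq_le_sq ?_ (by positivity)
  rw [mul_pow, norm_conj_diagonal_sq hU, norm_conj_diagonal_sq hU, Finset.mul_sum]
  refine Finset.sum_le_sum fun i _ => ?_
  rw [← sq_abs (w i), ← sq_abs (v i), ← mul_pow]
  exact pow_le_pow_left₀ (abs_nonneg _) (h i) 2

theorem abs_le_norm_conj_diagonal (hU : Uᵀ * U = 1) (w : Fin r → ℝ) (i : Fin r) :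
    |w i| ≤ ‖U * Matrix.diagonal w * Uᵀ‖ := by
  refine le_of_sq_le_sq ?_ (by positivity)
  rw [norm_conj_diagonal_sq hU, sq_abs]
  exact Finset.single_le_sum (f := fun i => w i ^ 2) (fun i _ => sq_nonneg _) (Finset.mem_univ i)

theorem conj_diagonal_mul (hU : Uᵀ * U = 1) (w v : Fin r → ℝ) :
    (U * Matrix.diagonal w * Uᵀ) * (U * Matrix.diagonal v * Uᵀ) =
      U * Matrix.diagonal (fun i => w i * v i) * Uᵀ := by
  rw [← Matrix.diagonal_mul_diagonal]
  simp only [Matrix.mul_assoc]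
  rw [← Matrix.mul_assoc Uᵀ U, hU, Matrix.one_mul]

theorem conj_diagonal_add (w v : Fin r → ℝ) :
    U * Matrix.diagonal w * Uᵀ + U * Matrix.diagonal v * Uᵀ =
      U * Matrix.diagonal (fun i => w i + v i) * Uᵀ := by
  rw [← Matrix.diagonal_add, Matrix.mul_add, Matrix.add_mul]

theorem conj_diagonal_sub (w v : Fin r → ℝ) :
    U * Matrix.diagonal w * Uᵀ - U * Matrix.diagonal v * Uᵀ =
      U * Matrix.diagonal (fun i => w i - v i) * Uᵀ := by
  rw [← Matrix.diagonal_sub, Matrix.mul_sub, Matrix.sub_mul]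

theorem conj_diagonal_smul (c : ℝ) (w : Fin r → ℝ) :
    c • (U * Matrix.diagonal w * Uᵀ) = U * Matrix.diagonal (fun i => c * w i) * Uᵀ := by
  change _ = U * Matrix.diagonal (c • w) * Uᵀ
  rw [Matrix.diagonal_smul, Matrix.mul_smul, Matrix.smul_mul]

theorem conj_diagonal_one (hU : U * Uᵀ = 1) : U * Matrix.diagonal (fun _ => (1 : ℝ)) * Uᵀ = 1 := by
  rw [Matrix.diagonal_one, Matrix.mul_one, hU]

theorem conj_diagonal_transpose (w : Fin r → ℝ) :
    (U * Matrix.diagonal w * Uᵀ)ᵀ = U * Matrix.diagonal w * Uᵀ := by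
  simp [Matrix.transpose_mul, Matrix.mul_assoc]

theorem inner_conj_diagonal_gram_nonneg {w : Fin r → ℝ} (hw : ∀ i, 0 ≤ w i)
    (Z : Matrix (Fin d) (Fin r) ℝ) : 0 ≤ ⟪U * Matrix.diagonal w * Uᵀ, Zᵀ * Z⟫ := by
  have : ⟪U * Matrix.diagonal w * Uᵀ, Zᵀ * Z⟫ = ∑ i, w i * ∑ j, (Z * U) j i ^ 2 := by
    rw [inner_mul_right_eq, inner_mul_left_eq, Matrix.transpose_transpose, inner_eq_trace,
      ← Matrix.mul_assoc, ← Matrix.mul_assoc, ← Matrix.transpose_mul, Matrix.mul_assoc _ Z U,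
      Matrix.trace]
    refine Finset.sum_congr rfl fun i _ => ?_
    rw [Matrix.diag_apply, Matrix.diagonal_mul]
    congr 1
    rw [Matrix.transpose_apply, Matrix.mul_apply]
    simp [pow_two]
  rw [this]
  exact Finset.sum_nonneg fun i _ => mul_nonneg (hw i) (Finset.sum_nonneg fun j _ => sq_nonneg _)

end Spectral

/-! ### The polar factor and its distance estimates. -/

section Polar

variable {d r m : ℕ}

theorem norm_mul_of_stiefel {y : Matrix (Fin d) (Fin r) ℝ} (hy : yᵀ * y = 1)
    (A : Matrix (Fin r) (Fin m) ℝ) : ‖y * A‖ = ‖A‖ := by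
  have := norm_mul_sq_sub y A
  rw [hy, sub_self, Matrix.zero_mul, inner_zero_right, add_zero] at this
  exact (sq_eq_sq₀ (norm_nonneg _) (norm_nonneg _)).1 this

theorem abs_sub_one_le_of_sq {p : ℝ} (hp : 1 / 2 ≤ p) : |p - 1| ≤ 2 / 3 * |p ^ 2 - 1| := by
  rw [show p ^ 2 - 1 = (p - 1) * (p + 1) by ring, abs_mul,
    abs_of_pos (show 0 < p + 1 by linarith)]
  nlinarith [abs_nonneg (p - 1)]

/-- The number `1 + t(p - 1)` lies between `1` and `p`. Applied to singular values, this keeps the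
segment from the polar factor to `x` in the safety region. -/
theorem abs_segment_sq_sub_one_le {p t : ℝ} (hp : 0 ≤ p) (ht : 0 ≤ t) (ht' : t ≤ 1) :
    |(1 + t * (p - 1)) ^ 2 - 1| ≤ |p ^ 2 - 1| := by
  rw [show (1 + t * (p - 1)) ^ 2 - 1 = (p - 1) * (t * (2 + t * (p - 1))) by ring,
    show p ^ 2 - 1 = (p - 1) * (p + 1) by ring, abs_mul (p - 1), abs_mul (p - 1)]
  refine mul_le_mul_of_nonneg_left ?_ (abs_nonneg _)
  have h1 : 0 ≤ 2 + t * (p - 1) := by nlinarith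
  rw [abs_of_nonneg (mul_nonneg ht h1), abs_of_nonneg (by linarith : 0 ≤ p + 1)]
  nlinarith [mul_nonneg hp ht, mul_nonneg ht (sub_nonneg.2 ht'), mul_nonneg hp (sub_nonneg.2 ht'), mul_nonneg (mul_nonneg hp ht) (sub_nonneg.2 ht')]

theorem one_sub_le_of_one_sub_le_sq {ε p : ℝ} (hε : 0 ≤ ε) (hp0 : 0 ≤ p)
    (hp : 1 - ε ≤ p ^ 2) : 1 - ε ≤ p := by
  by_contra h
  push Not at h
  nlinarith

theorem sq_sub_one_bound {ε p : ℝ} (hε : 0 ≤ ε) (hε' : ε < 3 / 4) (hp0 : 0 ≤ p)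
    (hp : 1 - ε ≤ p ^ 2) : (3 - 4 * ε) * (p - 1) ^ 2 ≤ (1 - ε) * (p ^ 2 - 1) ^ 2 := by
  have hp1 := one_sub_le_of_one_sub_le_sq hε hp0 hp
  -- At `p = 1 - ε` the gap `(1 - ε)(2 - ε)² - (3 - 4ε)` equals `(1 - 2ε)² + ε²(1 - ε)`.
  have h1 : (3 - 4 * ε) ≤ (1 - ε) * (1 + p) ^ 2 := by
    have : (2 - ε) ^ 2 ≤ (1 + p) ^ 2 := by nlinarith
    have h2 := mul_le_mul_of_nonneg_left this (by linarith : 0 ≤ 1 - ε)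
    nlinarith [mul_nonneg hε (sq_nonneg (ε - 1 / 2)), sq_nonneg (ε - 1 / 2)]
  have := mul_le_mul_of_nonneg_right h1 (sq_nonneg (p - 1))
  linarith [show (1 - ε) * (p ^ 2 - 1) ^ 2 = (1 - ε) * (1 + p) ^ 2 * (p - 1) ^ 2 by ring]

/-- The functions `1 - 1/p` and `(p² - 1)/2` agree to first order at `p = 1`; their difference has
the explicit factor `(p - 1)²`. -/
theorem abs_one_sub_inv_sub_le {ε p : ℝ} (hp0 : 0 < p)
    (hp : 1 - ε ≤ p ^ 2) (hp2 : p ^ 2 ≤ 7 / 4) :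
    (3 - 4 * ε) * |1 - 1 / p - 1 / 2 * (p ^ 2 - 1)| ≤ 3 / 2 * (p ^ 2 - 1) ^ 2 := by
  have e : 1 - 1 / p - 1 / 2 * (p ^ 2 - 1) = -((p - 1) ^ 2 * ((p + 2) / (2 * p))) := by
    field_simp
    ring
  rw [e, abs_neg, abs_of_nonneg (by positivity),
    show 3 / 2 * (p ^ 2 - 1) ^ 2 = (p - 1) ^ 2 * (3 / 2 * (p + 1) ^ 2) by ring, mul_left_comm]
  refine mul_le_mul_of_nonneg_left ?_ (sq_nonneg _)
  rw [← mul_div_assoc, div_le_iff₀ (by positivity)]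
  have h1 : (3 - 4 * ε) * (p + 2) ≤ (4 * p ^ 2 - 1) * (p + 2) :=
    mul_le_mul_of_nonneg_right (by linarith) (by linarith)
  have hp3 : p ≤ 4 / 3 := by nlinarith
  nlinarith [mul_nonneg hp0.le (sub_nonneg.2 hp2)]

/-- The polar factor `y` of `x`, together with the symmetric matrices `E`, `R` for which
`x = y (1 + E)` and `y = x (1 - R)`. -/
theorem exists_polar {ε : ℝ} (hε : ε < 3 / 4) (x : Matrix (Fin d) (Fin r) ℝ)
    (hx : ‖xᵀ * x - 1‖ ≤ ε) :
    ∃ (y : Matrix (Fin d) (Fin r) ℝ) (E R : Matrix (Fin r) (Fin r) ℝ),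
      yᵀ * y = 1 ∧ Eᵀ = E ∧ Rᵀ = R ∧ x - y = y * E ∧ x - y = x * R ∧
      ‖x - y‖ ≤ 2 / 3 * ‖xᵀ * x - 1‖ ∧
      (3 - 4 * ε) * ‖x - y‖ ^ 2 ≤ (1 - ε) * ‖xᵀ * x - 1‖ ^ 2 ∧
      (∀ t : ℝ, 0 ≤ t → t ≤ 1 → ‖(1 + t • E) * (1 + t • E) - 1‖ ≤ ‖xᵀ * x - 1‖) ∧
      (∀ Z : Matrix (Fin d) (Fin r) ℝ,
        (√(1 - ‖xᵀ * x - 1‖) - 1) * ‖Z‖ ^ 2 ≤ ⟪E, Zᵀ * Z⟫) ∧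
      (3 - 4 * ε) * ‖R - (1 / 2 : ℝ) • (xᵀ * x - 1)‖ ≤ 3 / 2 * ‖xᵀ * x - 1‖ ^ 2 := by
  obtain ⟨U, w, hU, hU', hW⟩ := exists_eq_mul_diagonal_mul
    (show (xᵀ * x)ᵀ = xᵀ * x by simp)
  have hD : xᵀ * x - 1 = U * Matrix.diagonal (fun i => w i - 1) * Uᵀ := by
    rw [hW, ← conj_diagonal_sub, conj_diagonal_one hU']
  have hwn : ∀ i, |w i - 1| ≤ ‖xᵀ * x - 1‖ := fun i => by
    rw [hD]
    exact abs_le_norm_conj_diagonal hU (fun i => w i - 1) i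
  have hε0 : 0 ≤ ε := (norm_nonneg _).trans hx
  have hw : ∀ i, 1 - ‖xᵀ * x - 1‖ ≤ w i := fun i => by linarith [(abs_le.1 (hwn i)).1]
  have hwε : ∀ i, 1 - ε ≤ w i := fun i => by linarith [hw i]
  have hw0 : ∀ i, 0 < w i := fun i => by linarith [hwε i]
  obtain ⟨p, hp⟩ : ∃ p : Fin r → ℝ, ∀ i, p i = √(w i) := ⟨_, fun _ => rfl⟩
  have hp0 : ∀ i, 0 < p i := fun i => by rw [hp]; exact Real.sqrt_pos.2 (hw0 i)
  have hpw : ∀ i, p i ^ 2 = w i := fun i => by rw [hp]; exact Real.sq_sqrt (hw0 i).le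
  have hph : ∀ i, 1 / 2 ≤ p i := fun i => by
    have := hwε i
    rw [← hpw] at this
    nlinarith [hp0 i]
  -- With `p` the singular values of `x`, the matrix `Q` is `(xᵀx)^(-1/2)`, `E` is `(xᵀx)^(1/2) - 1`
  -- and `R` is `1 - Q`.
  obtain ⟨Q, hQ⟩ : ∃ Q, Q = U * Matrix.diagonal (fun i => 1 / p i) * Uᵀ := ⟨_, rfl⟩
  obtain ⟨E, hE⟩ : ∃ E, E = U * Matrix.diagonal (fun i => p i - 1) * Uᵀ := ⟨_, rfl⟩
  obtain ⟨R, hR⟩ : ∃ R, R = U * Matrix.diagonal (fun i => 1 - 1 / p i) * Uᵀ := ⟨_, rfl⟩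
  have hQt : Qᵀ = Q := by rw [hQ, conj_diagonal_transpose]
  have hy : (x * Q)ᵀ * (x * Q) = 1 := by
    rw [Matrix.transpose_mul, hQt, Matrix.mul_assoc, ← Matrix.mul_assoc xᵀ, hW, hQ,
      conj_diagonal_mul hU, conj_diagonal_mul hU, ← conj_diagonal_one hU']
    congr 3
    funext i
    rw [← hpw]
    have := (hp0 i).ne'
    field_simp
  have hxR : x - x * Q = x * R := by
    rw [hR, ← conj_diagonal_sub, conj_diagonal_one hU', ← hQ, Matrix.mul_sub, Matrix.mul_one]
  have hyE : x - x * Q = x * Q * E := by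
    rw [hxR, Matrix.mul_assoc, hQ, hE, hR, conj_diagonal_mul hU]
    congr 4
    funext i
    have := (hp0 i).ne'
    field_simp
  have hnE : ‖x - x * Q‖ = ‖E‖ := by rw [hyE, norm_mul_of_stiefel hy]
  refine ⟨x * Q, E, R, hy, ?_, ?_, hyE, hxR, ?_, ?_, ?_, ?_, ?_⟩
  · rw [hE, conj_diagonal_transpose]
  · rw [hR, conj_diagonal_transpose]
  · rw [hnE, hE, hD]
    refine norm_conj_diagonal_le hU (by norm_num) fun i => ?_
    rw [← hpw]
    exact abs_sub_one_le_of_sq (hph i)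
  · rw [hnE, hE, hD, norm_conj_diagonal_sq hU, norm_conj_diagonal_sq hU, Finset.mul_sum,
      Finset.mul_sum]
    refine Finset.sum_le_sum fun i _ => ?_
    rw [← hpw]
    exact sq_sub_one_bound hε0 hε (hp0 i).le (by rw [hpw]; exact hwε i)
  · intro t ht ht'
    have e : (1 : Matrix (Fin r) (Fin r) ℝ) + t • E
        = U * Matrix.diagonal (fun i => 1 + t * (p i - 1)) * Uᵀ := by
      rw [← conj_diagonal_add, conj_diagonal_one hU', hE, conj_diagonal_smul]
    rw [e, conj_diagonal_mul hU, hD]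
    nth_rewrite 1 [← conj_diagonal_one hU']
    rw [conj_diagonal_sub]
    rw [← one_mul ‖U * Matrix.diagonal (fun i => w i - 1) * Uᵀ‖]
    refine norm_conj_diagonal_le hU zero_le_one fun i => ?_
    rw [← hpw, one_mul, ← pow_two]
    exact abs_segment_sq_sub_one_le (hp0 i).le ht ht'
  · intro Z
    have h := inner_conj_diagonal_gram_nonneg (U := U)
      (w := fun i => (p i - 1) - (√(1 - ‖xᵀ * x - 1‖) - 1) * 1) (fun i => by
        have : √(1 - ‖xᵀ * x - 1‖) ≤ p i := by rw [hp]; exact Real.sqrt_le_sqrt (hw i)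
        linarith) Z
    rw [← conj_diagonal_sub, ← conj_diagonal_smul, conj_diagonal_one hU', ← hE, inner_sub_left,
      real_inner_smul_left] at h
    have h1 : ⟪(1 : Matrix (Fin r) (Fin r) ℝ), Zᵀ * Z⟫ = ‖Z‖ ^ 2 := by
      rw [← real_inner_self_eq_norm_sq, real_inner_comm, inner_mul_left_eq,
        Matrix.transpose_transpose, Matrix.mul_one]
    rw [h1] at h
    linarith
  · have h3 : 0 < 3 - 4 * ε := by linarith
    have e : R - (1 / 2 : ℝ) • (xᵀ * x - 1)
        = U * Matrix.diagonal (fun i => 1 - 1 / p i - 1 / 2 * (w i - 1)) * Uᵀ := by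
      rw [← conj_diagonal_sub, ← conj_diagonal_smul, hD, hR]
    have h := norm_conj_diagonal_le hU (w := fun i => 1 - 1 / p i - 1 / 2 * (w i - 1))
      (v := fun i => w i - 1) (c := 3 / 2 / (3 - 4 * ε) * ‖xᵀ * x - 1‖) (by positivity)
      (fun i => by
        have h1 := abs_one_sub_inv_sub_le (hp0 i) (by rw [hpw]; exact hwε i)
          (by rw [hpw]; linarith [(abs_le.1 (hwn i)).2])
        rw [hpw, ← sq_abs] at h1
        refine le_of_mul_le_mul_left (h1.trans ?_) h3
        have e2 : (3 - 4 * ε) * (3 / 2 / (3 - 4 * ε) * ‖xᵀ * x - 1‖ * |w i - 1|)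
            = 3 / 2 * ‖xᵀ * x - 1‖ * |w i - 1| := by field_simp
        rw [e2]
        nlinarith [mul_le_mul_of_nonneg_right (hwn i) (abs_nonneg (w i - 1))])
    rw [e]
    rw [← hD] at h
    calc _ ≤ _ := mul_le_mul_of_nonneg_left h h3.le
      _ = _ := by field_simp

/-- Projecting onto the Stiefel manifold expands distances to its points by a bounded factor. -/
theorem sqrt_mul_norm_sub_sq_le {x y z : Matrix (Fin d) (Fin r) ℝ}
    {E : Matrix (Fin r) (Fin r) ℝ} {s : ℝ} (hy : yᵀ * y = 1) (hz : zᵀ * z = 1) (hE : Eᵀ = E)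
    (hxy : x - y = y * E)
    (hs : ∀ Z : Matrix (Fin d) (Fin r) ℝ, (s - 1) * ‖Z‖ ^ 2 ≤ ⟪E, Zᵀ * Z⟫) :
    s * ‖y - z‖ ^ 2 ≤ ‖x - z‖ ^ 2 := by
  have h1 : ‖x - z‖ ^ 2 = ‖x - y‖ ^ 2 + 2 * ⟪x - y, y - z⟫ + ‖y - z‖ ^ 2 := by
    rw [← norm_add_sq_real, sub_add_sub_cancel]
  -- For Stiefel points `y` and `z`, twice the symmetric part of `yᵀ(y - z)` is the Gram matrix of
  -- `y - z`, so the lower bound on `E` controls the cross term.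
  have h2 : 2 * ⟪x - y, y - z⟫ = ⟪E, (y - z)ᵀ * (y - z)⟫ := by
    have e1 : (y - z)ᵀ * (y - z) = yᵀ * (y - z) + (yᵀ * (y - z))ᵀ := by
      simp only [Matrix.transpose_sub, Matrix.sub_mul, Matrix.mul_sub, Matrix.transpose_mul,
        Matrix.transpose_transpose, hy, hz]
      simp only [Matrix.transpose_one]
      abel
    rw [e1, inner_add_right, hxy, inner_mul_left_eq, ← inner_transpose E (yᵀ * (y - z))ᵀ, hE,
      Matrix.transpose_transpose]
    ring
  have h3 := hs (y - z)
  have h4 := sq_nonneg ‖x - y‖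
  linarith

end Polar

/-! ### Derivatives along lines and the descent lemma. -/

section Lines

variable {E F : Type*} [NormedAddCommGroup F] [NormedSpace ℝ F]

theorem hasDerivAt_of_eq_cubic {φ : ℝ → F} {A B C D : F}
    (h : ∀ t, φ t = A + t • B + t ^ 2 • C + t ^ 3 • D) : HasDerivAt φ B 0 := by
  rw [funext h]
  have h1 := (((hasDerivAt_id (0 : ℝ)).smul_const B).const_add A).add
    ((hasDerivAt_pow 2 (0 : ℝ)).smul_const C) |>.add ((hasDerivAt_pow 3 (0 : ℝ)).smul_const D)
  exact h1.congr_deriv (by simp)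

variable [NormedAddCommGroup E] [InnerProductSpace ℝ E]

theorem hasDerivAt_add_smul (x v : E) (t : ℝ) : HasDerivAt (fun t : ℝ => x + t • v) v t := by
  simpa using ((hasDerivAt_id t).smul_const v).const_add x

theorem hasDerivAt_line [CompleteSpace E] {φ : E → ℝ} (h : Differentiable ℝ φ) (x v : E) (t : ℝ) :
    HasDerivAt (fun t : ℝ => φ (x + t • v)) ⟪∇ φ (x + t • v), v⟫ t := by
  rw [inner_gradient_left]
  exact (h (x + t • v)).hasFDerivAt.comp_hasDerivAt t (hasDerivAt_add_smul x v t)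

theorem hasDerivAt_line_zero [CompleteSpace E] {φ : E → ℝ} (h : Differentiable ℝ φ) (x v : E) :
    HasDerivAt (fun t : ℝ => φ (x + t • v)) ⟪∇ φ x, v⟫ 0 := by
  simpa using hasDerivAt_line h x v 0

theorem exists_linear_hasDerivAt_line {ψ : E → E} {L : ℝ≥0} (h : Differentiable ℝ ψ)
    (hL : LipschitzWith L ψ) (x : E) : ∃ H : E →ₗ[ℝ] E,
      (∀ v, HasDerivAt (fun t : ℝ => ψ (x + t • v)) (H v) 0) ∧ ∀ v, ‖H v‖ ≤ L * ‖v‖ := by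
  refine ⟨fderiv ℝ ψ x, fun v => ?_, fun v => ?_⟩
  · have h1 : HasFDerivAt ψ (fderiv ℝ ψ x) (x + (0 : ℝ) • v) := by
      rw [zero_smul, add_zero]
      exact (h x).hasFDerivAt
    exact h1.comp_hasDerivAt 0 (hasDerivAt_add_smul x v 0)
  · exact (ContinuousLinearMap.le_opNorm _ _).trans
      (mul_le_mul_of_nonneg_right (norm_fderiv_le_of_lipschitz ℝ hL) (norm_nonneg _))

/-- The quadratic upper bound for a function with Lipschitz gradient. -/
theorem le_quadratic_of_lipschitz_gradient [CompleteSpace E] {f : E → ℝ} {L : ℝ≥0}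
    (hf : Differentiable ℝ f) (hL : LipschitzWith L (∇ f)) (x y : E) :
    f y ≤ f x + ⟪∇ f x, y - x⟫ + L / 2 * ‖y - x‖ ^ 2 := by
  set v := y - x with hv
  let φ : ℝ → ℝ := fun t => f (x + t • v) - t * ⟪∇ f x, v⟫ - L / 2 * ‖v‖ ^ 2 * t ^ 2
  have hφ : ∀ t, HasDerivAt φ (⟪∇ f (x + t • v), v⟫ - ⟪∇ f x, v⟫ - L * ‖v‖ ^ 2 * t) t := by
    intro t
    have h2 := hasDerivAt_line hf x v t
    have h3 := (h2.sub ((hasDerivAt_id t).mul_const ⟪∇ f x, v⟫)).sub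
      ((hasDerivAt_pow 2 t).const_mul (L / 2 * ‖v‖ ^ 2))
    refine h3.congr_deriv ?_
    simp
    ring
  have hanti : AntitoneOn φ (Set.Icc 0 1) := by
    refine antitoneOn_of_deriv_nonpos (convex_Icc 0 1)
      (fun t _ => (hφ t).continuousAt.continuousWithinAt)
      (fun t _ => (hφ t).differentiableAt.differentiableWithinAt) fun t ht => ?_
    rw [interior_Icc] at ht
    rw [(hφ t).deriv, ← inner_sub_left]
    have h1 := real_inner_le_norm (∇ f (x + t • v) - ∇ f x) v
    have h2 := hL.dist_le_mul (x + t • v) x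
    rw [dist_eq_norm, dist_eq_norm, add_sub_cancel_left, norm_smul, Real.norm_of_nonneg ht.1.le] at h2
    have h3 := mul_le_mul_of_nonneg_right h2 (norm_nonneg v)
    linarith [pow_two ‖v‖, show (L : ℝ) * (t * ‖v‖) * ‖v‖ = L * ‖v‖ ^ 2 * t by ring]
  have h := hanti (Set.left_mem_Icc.2 zero_le_one) (Set.right_mem_Icc.2 zero_le_one) zero_le_one
  simp only [φ, one_smul, zero_smul, add_zero, hv, add_sub_cancel] at h
  rw [← hv] at h
  linarith

end Lines

/-! ### The merit function and its directional derivatives. -/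

section Merit

variable {d r : ℕ} {f : Matrix (Fin d) (Fin r) ℝ → ℝ} {L : ℝ≥0} {γ : ℝ}

theorem isBoundedBilinearMap_mul {k l m : ℕ} : IsBoundedBilinearMap ℝ
    (fun p : Matrix (Fin k) (Fin l) ℝ × Matrix (Fin l) (Fin m) ℝ => p.1 * p.2) where
  add_left := fun _ _ _ => Matrix.add_mul _ _ _
  smul_left := fun _ _ _ => Matrix.smul_mul _ _ _
  add_right := fun _ _ _ => Matrix.mul_add _ _ _
  smul_right := fun _ _ _ => Matrix.mul_smul _ _ _
  bound := ⟨1, one_pos, fun A B => by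
    rw [one_mul]
    exact Matrix.frobenius_norm_mul A B⟩

theorem isBoundedLinearMap_transpose {k l : ℕ} : IsBoundedLinearMap ℝ
    (fun A : Matrix (Fin k) (Fin l) ℝ => Aᵀ) where
  map_add := Matrix.transpose_add
  map_smul := Matrix.transpose_smul
  bound := ⟨1, one_pos, fun A => by rw [one_mul, Matrix.frobenius_norm_transpose]⟩

theorem differentiable_gram_sub_one :
    Differentiable ℝ (fun x : Matrix (Fin d) (Fin r) ℝ => xᵀ * x - 1) :=
  (isBoundedBilinearMap_mul.differentiable.comp
    (isBoundedLinearMap_transpose.differentiable.prodMk differentiable_id)).sub_const _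

theorem differentiable_mul_gram_sub_one :
    Differentiable ℝ (fun x : Matrix (Fin d) (Fin r) ℝ => x * (xᵀ * x - 1)) :=
  isBoundedBilinearMap_mul.differentiable.comp (differentiable_id.prodMk differentiable_gram_sub_one)

theorem merit_eq (x : Matrix (Fin d) (Fin r) ℝ) :
    merit f γ x = f x - 1 / 2 * ⟪∇ f x, x * (xᵀ * x - 1)⟫ + γ / 4 * ‖xᵀ * x - 1‖ ^ 2 := by
  rw [merit, meritCorrection, penalty, inner_symPart _ (gram_sub_one_transpose x),
    inner_mul_left_eq, Matrix.transpose_transpose]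
  ring

theorem merit_of_stiefel {y : Matrix (Fin d) (Fin r) ℝ} (hy : yᵀ * y = 1) :
    merit f γ y = f y := by
  rw [merit_eq, hy]
  simp

theorem IsSmoothObjective.differentiable (hf : IsSmoothObjective f L) : Differentiable ℝ f :=
  hf.1.differentiable (by norm_num)

theorem IsSmoothObjective.differentiable_gradient (hf : IsSmoothObjective f L) :
    Differentiable ℝ (∇ f) := by
  have h1 : Differentiable ℝ (fderiv ℝ f) :=
    (hf.1.fderiv_right (m := 1) (by norm_num)).differentiable (by norm_num)
  exact (InnerProductSpace.toDual ℝ (Matrix (Fin d) (Fin r) ℝ)).symm.toContinuousLinearEquiv.differentiable.comp h1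

theorem IsSmoothObjective.differentiable_merit (hf : IsSmoothObjective f L) :
    Differentiable ℝ (merit f γ) := by
  have : merit f γ = fun x => f x - 1 / 2 * ⟪∇ f x, x * (xᵀ * x - 1)⟫ + γ / 4 * ‖xᵀ * x - 1‖ ^ 2 :=
    funext merit_eq
  rw [this]
  exact (hf.differentiable.sub ((hf.differentiable_gradient.inner ℝ
    differentiable_mul_gram_sub_one).const_mul _)).add
    ((differentiable_gram_sub_one.norm_sq ℝ).const_mul _)

/-- Product rule along a line, where the Gram terms are polynomials in the parameter. The map `H` is
the Hessian of `f`, which enters later estimates only through its norm bound. -/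
theorem exists_inner_gradient_merit (hf : IsSmoothObjective f L) (x : Matrix (Fin d) (Fin r) ℝ) :
    ∃ H : Matrix (Fin d) (Fin r) ℝ →ₗ[ℝ] Matrix (Fin d) (Fin r) ℝ, (∀ v, ‖H v‖ ≤ L * ‖v‖) ∧
      ∀ v, ⟪∇ (merit f γ) x, v⟫ = ⟪∇ f x, v⟫ - 1 / 2 * ⟪H v, x * (xᵀ * x - 1)⟫
        - 1 / 2 * ⟪∇ f x, x * (xᵀ * v + vᵀ * x) + v * (xᵀ * x - 1)⟫
        + γ * ⟪x * (xᵀ * x - 1), v⟫ := by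
  obtain ⟨H, hH, hHL⟩ := exists_linear_hasDerivAt_line hf.differentiable_gradient hf.2 x
  refine ⟨H, hHL, fun v => ?_⟩
  have h1 := hasDerivAt_line_zero (hf.differentiable_merit (γ := γ)) x v
  have h2 := hasDerivAt_line_zero hf.differentiable x v
  have h4 := hasDerivAt_of_eq_cubic
    (φ := fun t : ℝ => (x + t • v) * ((x + t • v)ᵀ * (x + t • v) - 1))
    (A := x * (xᵀ * x - 1)) (B := x * (xᵀ * v + vᵀ * x) + v * (xᵀ * x - 1))
    (C := x * (vᵀ * v) + v * (xᵀ * v + vᵀ * x)) (D := v * (vᵀ * v)) (fun t => by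
      simp only [Matrix.transpose_add, Matrix.transpose_smul, Matrix.add_mul, Matrix.mul_add,
        Matrix.mul_sub, Matrix.smul_mul, Matrix.mul_smul, Matrix.mul_one]
      module)
  have h5 := hasDerivAt_of_eq_cubic
    (φ := fun t : ℝ => (x + t • v)ᵀ * (x + t • v) - 1)
    (A := xᵀ * x - 1) (B := xᵀ * v + vᵀ * x) (C := vᵀ * v) (D := 0) (fun t => by
      simp only [Matrix.transpose_add, Matrix.transpose_smul, Matrix.add_mul, Matrix.mul_add,
        Matrix.smul_mul, Matrix.mul_smul]
      module)
  have h6 := (h2.sub (((hH v).inner ℝ h4).const_mul (1 / 2))).add (h5.norm_sq.const_mul (γ / 4))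
  have h7 : ⟪xᵀ * x - 1, xᵀ * v + vᵀ * x⟫ = 2 * ⟪x * (xᵀ * x - 1), v⟫ := by
    rw [inner_add_right, ← inner_transpose _ (vᵀ * x), gram_sub_one_transpose,
      Matrix.transpose_mul, Matrix.transpose_transpose, inner_mul_left_eq]
    ring
  have h8 : (fun t : ℝ => merit f γ (x + t • v)) = _ := funext fun t => merit_eq (x + t • v)
  rw [h8] at h1
  refine (h1.unique h6).trans ?_
  simp only [zero_smul, add_zero, h7]
  ring

end Merit

/-! ### The landing field is a descent direction for the merit function. -/

section Descent

variable {d r : ℕ} {f : Matrix (Fin d) (Fin r) ℝ → ℝ} {L : ℝ≥0} {γ lam ε : ℝ}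

theorem inner_skew_mul_symm {k l : ℕ} {A : Matrix (Fin k) (Fin k) ℝ}
    {B : Matrix (Fin l) (Fin l) ℝ} (hA : Aᵀ = -A) (hB : Bᵀ = B) (x : Matrix (Fin k) (Fin l) ℝ) :
    ⟪A * x, x * B⟫ = 0 := by
  rw [inner_mul_right_eq, real_inner_comm]
  refine inner_eq_zero_of_symm_skew ?_ hA
  simp [Matrix.transpose_mul, hB, Matrix.mul_assoc]

theorem inner_relGrad_mul_gram (x : Matrix (Fin d) (Fin r) ℝ) :
    ⟪relGrad f x, x * (xᵀ * x - 1)⟫ = 0 :=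
  inner_skew_mul_symm (skewPart_transpose _) (gram_sub_one_transpose x) x

theorem norm_landingField_sq (x : Matrix (Fin d) (Fin r) ℝ) :
    ‖landingField f lam x‖ ^ 2 =
      ‖relGrad f x‖ ^ 2 + lam ^ 2 * ‖x * (xᵀ * x - 1)‖ ^ 2 := by
  rw [landingField, norm_add_sq_real, inner_smul_right, inner_relGrad_mul_gram, norm_smul, mul_pow,
    Real.norm_eq_abs, sq_abs]
  ring

theorem inner_gradient_relGrad (x : Matrix (Fin d) (Fin r) ℝ) :
    ⟪∇ f x, relGrad f x⟫ = ‖skewPart (∇ f x * xᵀ)‖ ^ 2 := by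
  rw [relGrad, real_inner_comm, inner_mul_right_eq, real_inner_comm,
    inner_skewPart _ (skewPart_transpose _), real_inner_self_eq_norm_sq]

theorem norm_relGrad_sq_le {n : ℝ} (x : Matrix (Fin d) (Fin r) ℝ) (hx : ‖xᵀ * x - 1‖ ≤ n) :
    ‖relGrad f x‖ ^ 2 ≤ (1 + n) * ‖skewPart (∇ f x * xᵀ)‖ ^ 2 := by
  have h0 : 0 ≤ 1 + n := by linarith [norm_nonneg (xᵀ * x - 1)]
  have := pow_le_pow_left₀ (norm_nonneg _)
    (norm_mul_base_le_sqrt x hx (skewPart (∇ f x * xᵀ))) 2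
  rwa [mul_pow, Real.sq_sqrt h0] at this

theorem norm_relGrad_le {n : ℝ} (x : Matrix (Fin d) (Fin r) ℝ) (hx : ‖xᵀ * x - 1‖ ≤ n) :
    ‖relGrad f x‖ ≤ (1 + n) * ‖∇ f x‖ := by
  have h0 : 0 ≤ 1 + n := by linarith [norm_nonneg (xᵀ * x - 1)]
  calc ‖relGrad f x‖ ≤ √(1 + n) * ‖skewPart (∇ f x * xᵀ)‖ := norm_mul_base_le_sqrt x hx _
    _ ≤ √(1 + n) * (√(1 + n) * ‖∇ f x‖) := by
      gcongr
      exact (norm_skewPart_le _).trans (norm_mul_transpose_le_sqrt x hx _)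
    _ = (1 + n) * ‖∇ f x‖ := by rw [← mul_assoc, Real.mul_self_sqrt h0]

/-- Boundedness of the region makes the real suprema in `symSup` and `Lhat` genuine upper bounds. -/
theorem exists_norm_le_of_mem_safeRegion (d r : ℕ) (ε : ℝ) :
    ∃ C, ∀ x ∈ safeRegion d r ε, ‖x‖ ≤ C := by
  refine ⟨√(1 + ε) * ‖(1 : Matrix (Fin r) (Fin r) ℝ)‖, fun x hx => ?_⟩
  have := norm_mul_le_sqrt x hx (1 : Matrix (Fin r) (Fin r) ℝ)
  rwa [Matrix.mul_one] at this

theorem IsSmoothObjective.norm_gradient_le (hf : IsSmoothObjective f L)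
    (x : Matrix (Fin d) (Fin r) ℝ) : ‖∇ f x‖ ≤ ‖∇ f 0‖ + L * ‖x‖ := by
  have h := hf.2.dist_le_mul x 0
  rw [dist_eq_norm, dist_eq_norm, sub_zero] at h
  linarith [norm_le_norm_add_norm_sub' (∇ f x) (∇ f 0)]

theorem IsSmoothObjective.norm_gradient_le_Lhat (hf : IsSmoothObjective f L)
    {x : Matrix (Fin d) (Fin r) ℝ} (hx : x ∈ safeRegion d r ε) : ‖∇ f x‖ ≤ Lhat f L ε := by
  obtain ⟨C, hC⟩ := exists_norm_le_of_mem_safeRegion d r ε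
  refine le_max_of_le_right (le_csSup ⟨‖∇ f 0‖ + L * C, ?_⟩ ⟨x, hx, rfl⟩)
  rintro _ ⟨z, hz, rfl⟩
  exact (hf.norm_gradient_le z).trans (by gcongr; exact hC z hz)

theorem IsSmoothObjective.norm_symPart_le_symSup (hf : IsSmoothObjective f L)
    {x : Matrix (Fin d) (Fin r) ℝ} (hx : x ∈ safeRegion d r ε) :
    ‖symPart (xᵀ * ∇ f x)‖ ≤ symSup f ε := by
  obtain ⟨C, hC⟩ := exists_norm_le_of_mem_safeRegion d r ε
  have hC0 : 0 ≤ C := (norm_nonneg _).trans (hC x hx)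
  refine le_csSup ⟨C * (‖∇ f 0‖ + L * C), ?_⟩ ⟨x, hx, rfl⟩
  rintro _ ⟨z, hz, rfl⟩
  refine (norm_symPart_le _).trans ((Matrix.frobenius_norm_mul _ _).trans ?_)
  rw [Matrix.frobenius_norm_transpose]
  exact mul_le_mul (hC z hz) ((hf.norm_gradient_le z).trans (by gcongr; exact hC z hz))
    (norm_nonneg _) hC0

theorem le_Lhat : (L : ℝ) ≤ Lhat f L ε := le_max_left _ _

theorem inner_gradient_mul (x : Matrix (Fin d) (Fin r) ℝ) {B : Matrix (Fin r) (Fin r) ℝ}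
    (hB : Bᵀ = B) : ⟪∇ f x, x * B⟫ = ⟪symPart (xᵀ * ∇ f x), B⟫ := by
  rw [inner_symPart _ hB, real_inner_comm, inner_mul_left_eq, real_inner_comm]

/-- A skew matrix times `x` does not change `xᵀx` to first order, so only the penalty part of the
field contributes. -/
theorem transpose_mul_landingField_add (x : Matrix (Fin d) (Fin r) ℝ) :
    xᵀ * landingField f lam x + (landingField f lam x)ᵀ * x
      = (2 * lam) • ((xᵀ * x - 1) + (xᵀ * x - 1) * (xᵀ * x - 1)) := by
  obtain ⟨D, hD⟩ : ∃ D, D = xᵀ * x - 1 := ⟨_, rfl⟩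
  have hW : xᵀ * x = D + 1 := by rw [hD]; abel
  have hDt : Dᵀ = D := by rw [hD]; exact gram_sub_one_transpose x
  rw [← hD]
  have h1 : xᵀ * relGrad f x + (relGrad f x)ᵀ * x = 0 := by
    rw [relGrad, Matrix.transpose_mul, skewPart_transpose, Matrix.mul_neg, Matrix.neg_mul,
      Matrix.mul_assoc, add_neg_cancel]
  have h2 : xᵀ * (x * D) = D + D * D := by
    rw [← Matrix.mul_assoc, hW, Matrix.add_mul, Matrix.one_mul, add_comm]
  have h3 : (x * D)ᵀ * x = D + D * D := by
    rw [Matrix.transpose_mul, hDt, Matrix.mul_assoc, hW, Matrix.mul_add, Matrix.mul_one, add_comm]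
  rw [landingField, ← hD, Matrix.mul_add, Matrix.transpose_add, Matrix.add_mul,
    add_add_add_comm, h1, Matrix.transpose_smul, Matrix.mul_smul, Matrix.smul_mul, h2, h3]
  module

/-- The term `lam ⟨∇f, xD⟩` is cancelled by the derivative of the correction. The remaining
indefinite terms are at least quadratic in `relGrad` and `D`, hence can be absorbed. -/
theorem exists_inner_gradient_merit_landingField (hf : IsSmoothObjective f L)
    (x : Matrix (Fin d) (Fin r) ℝ) :
    ∃ H : Matrix (Fin d) (Fin r) ℝ →ₗ[ℝ] Matrix (Fin d) (Fin r) ℝ, (∀ v, ‖H v‖ ≤ L * ‖v‖) ∧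
      ⟪∇ (merit f γ) x, landingField f lam x⟫ = ‖skewPart (∇ f x * xᵀ)‖ ^ 2
        - 1 / 2 * ⟪H (relGrad f x), x * (xᵀ * x - 1)⟫
        - 1 / 2 * lam * ⟪H (x * (xᵀ * x - 1)), x * (xᵀ * x - 1)⟫
        - 3 / 2 * lam * ⟪symPart (xᵀ * ∇ f x), (xᵀ * x - 1) * (xᵀ * x - 1)⟫
        - 1 / 2 * ⟪∇ f x, relGrad f x * (xᵀ * x - 1)⟫
        + γ * lam * ‖x * (xᵀ * x - 1)‖ ^ 2 := by
  obtain ⟨H, hHL, hH⟩ := exists_inner_gradient_merit (γ := γ) hf x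
  refine ⟨H, hHL, ?_⟩
  obtain ⟨D, hD⟩ : ∃ D, D = xᵀ * x - 1 := ⟨_, rfl⟩
  have hDt : Dᵀ = D := by rw [hD]; exact gram_sub_one_transpose x
  have hDDt : (D * D)ᵀ = D * D := by rw [Matrix.transpose_mul, hDt]
  have e1 := transpose_mul_landingField_add (f := f) (lam := lam) x
  rw [← hD] at e1
  rw [hH, e1, ← hD]
  have e2 : x * ((2 * lam) • (D + D * D)) + landingField f lam x * D
      = (2 * lam) • (x * D) + (3 * lam) • (x * (D * D)) + relGrad f x * D := by
    rw [landingField, ← hD, Matrix.mul_smul, Matrix.mul_add, Matrix.add_mul, Matrix.smul_mul,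
      Matrix.mul_assoc x D D]
    module
  have e3 := inner_relGrad_mul_gram (f := f) x
  rw [← hD] at e3
  rw [e2, landingField, ← hD, map_add, map_smul]
  simp only [inner_add_left, inner_add_right, inner_smul_left, inner_smul_right,
    inner_gradient_relGrad, inner_gradient_mul x hDt, inner_gradient_mul x hDDt,
    real_inner_self_eq_norm_sq, real_inner_comm (relGrad f x) (x * D), e3, conj_trivial]
  ring

theorem descent_scalar_bound {ε L Lh s lam γ p g n N a b c e : ℝ} (hε : 0 < ε) (hε' : ε < 3 / 4)
    (hlam : 0 < lam) (hL : 0 ≤ L) (hLh : L ≤ Lh) (hs : 0 ≤ s)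
    (hγ : L * (1 - ε) + 3 * s + Lh ^ 2 * ((1 + ε) ^ 2 / (lam * (1 - ε))) ≤ γ * ((3 - 4 * ε) / 2))
    (hg : 0 ≤ g) (hn : 0 ≤ n) (hp : g ^ 2 ≤ (1 + ε) * p)
    (hN1 : (1 - ε) * n ^ 2 ≤ N ^ 2) (hN2 : N ≤ √(1 + ε) * n)
    (ha : a ≤ L * g * N) (hb : b ≤ L * N ^ 2) (hc : c ≤ s * n ^ 2) (he : e ≤ Lh * (g * n)) :
    1 / 2 * g ^ 2 + γ * lam / 4 * n ^ 2 ≤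
      p - 1 / 2 * a - 1 / 2 * lam * b - 3 / 2 * lam * c - 1 / 2 * e + γ * lam * N ^ 2 := by
  have h1ε : 0 < 1 - ε := by linarith
  obtain ⟨u, hu⟩ : ∃ u, u = √(1 + ε) := ⟨_, rfl⟩
  have hu2 : u ^ 2 = 1 + ε := by rw [hu]; exact Real.sq_sqrt (by linarith)
  have hu1 : 1 ≤ u := by rw [hu]; exact Real.one_le_sqrt.2 (by linarith)
  rw [← hu] at hN2
  have hgn : 0 ≤ g * n := mul_nonneg hg hn
  have ha' : a ≤ Lh * u * (g * n) := by
    have h1 := mul_le_mul_of_nonneg_left hN2 (mul_nonneg hL hg)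
    have h2 := mul_le_mul_of_nonneg_right hLh (mul_nonneg (by linarith : 0 ≤ u) hgn)
    linarith
  have he' : e ≤ Lh * u * (g * n) := by
    have h2 := mul_le_mul_of_nonneg_left hu1 (mul_nonneg (hL.trans hLh) hgn)
    linarith
  -- Young's inequality: since `p ≥ g²/(1 + ε)`, reserving `g²/2` leaves `(1 - ε)/(2(1 + ε)) g²` to
  -- absorb the mixed terms. The price in `n²` is the `Lh²` summand of `γ`.
  have hsq : 1 / 2 * g ^ 2 - Lh ^ 2 * ((1 + ε) ^ 2 / (2 * (1 - ε))) * n ^ 2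
      ≤ p - Lh * u * (g * n) := by
    have h3 : 0 < 2 * (1 - ε) * (1 + ε) := by positivity
    refine le_of_mul_le_mul_left ?_ h3
    have e1 : 2 * (1 - ε) * (1 + ε) * (1 / 2 * g ^ 2 - Lh ^ 2 * ((1 + ε) ^ 2 / (2 * (1 - ε))) * n ^ 2)
        = (1 - ε) * (1 + ε) * g ^ 2 - Lh ^ 2 * (1 + ε) ^ 3 * n ^ 2 := by
      field_simp
    rw [e1]
    have h4 := sq_nonneg ((1 - ε) * g - Lh * (1 + ε) * u * n)
    have h5 := mul_le_mul_of_nonneg_left hp (by linarith : 0 ≤ 2 * (1 - ε))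
    have e2 : ((1 - ε) * g - Lh * (1 + ε) * u * n) ^ 2 = (1 - ε) ^ 2 * g ^ 2
        - 2 * (1 - ε) * (1 + ε) * (Lh * u * (g * n)) + Lh ^ 2 * (1 + ε) ^ 2 * n ^ 2 * u ^ 2 := by ring
    rw [e2, hu2] at h4
    linarith
  have hX : 0 ≤ Lh ^ 2 * ((1 + ε) ^ 2 / (lam * (1 - ε))) := by positivity
  -- This sign allows `N²` to be replaced by its lower bound after the Hessian term has been
  -- subtracted.
  have hγL : L / 2 ≤ γ := by
    by_contra h
    push Not at h
    have h6 : γ * ((3 - 4 * ε) / 2) ≤ L / 2 * ((3 - 4 * ε) / 2) :=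
      mul_le_mul_of_nonneg_right h.le (by linarith)
    have h7 := mul_nonneg hL h1ε.le
    have hL0 : L = 0 := by nlinarith
    subst hL0
    nlinarith
  have h8 := mul_le_mul_of_nonneg_left hN1 (mul_nonneg hlam.le (sub_nonneg.2 hγL))
  have h9 := mul_le_mul_of_nonneg_right hγ (by positivity : 0 ≤ lam / 2 * n ^ 2)
  have e3 : Lh ^ 2 * ((1 + ε) ^ 2 / (lam * (1 - ε))) * (lam / 2 * n ^ 2)
      = Lh ^ 2 * ((1 + ε) ^ 2 / (2 * (1 - ε))) * n ^ 2 := by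
    field_simp
  have h10 := mul_le_mul_of_nonneg_left hb (by positivity : 0 ≤ 1 / 2 * lam)
  have h11 := mul_le_mul_of_nonneg_left hc (by positivity : 0 ≤ 3 / 2 * lam)
  nlinarith

theorem le_mul_of_gammaMin_le (hε' : ε < 3 / 4) (hγ : gammaMin f L ε lam ≤ γ) :
    L * (1 - ε) + 3 * symSup f ε + Lhat f L ε ^ 2 * ((1 + ε) ^ 2 / (lam * (1 - ε)))
      ≤ γ * ((3 - 4 * ε) / 2) := by
  have h : 0 < 3 - 4 * ε := by linarith
  rw [gammaMin, div_mul_eq_mul_div, div_le_iff₀ h] at hγ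
  linarith

theorem le_inner_gradient_merit_landingField (hf : IsSmoothObjective f L) (hε : 0 < ε)
    (hε' : ε < 3 / 4) (hlam : 0 < lam) (hγ : gammaMin f L ε lam ≤ γ)
    {x : Matrix (Fin d) (Fin r) ℝ} (hx : x ∈ safeRegion d r ε) :
    1 / 2 * ‖relGrad f x‖ ^ 2 + γ * lam / 4 * ‖xᵀ * x - 1‖ ^ 2
      ≤ ⟪∇ (merit f γ) x, landingField f lam x⟫ := by
  obtain ⟨H, hHL, hH⟩ := exists_inner_gradient_merit_landingField (γ := γ) (lam := lam) hf x
  have hs : ‖symPart (xᵀ * ∇ f x)‖ ≤ symSup f ε := hf.norm_symPart_le_symSup hx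
  rw [hH]
  refine descent_scalar_bound hε hε' hlam L.2 (le_Lhat (f := f) (ε := ε))
    ((norm_nonneg _).trans hs) (le_mul_of_gammaMin_le hε' hγ) (norm_nonneg _) (norm_nonneg _)
    (norm_relGrad_sq_le x hx) (le_norm_mul_sq x hx _) (norm_mul_le_sqrt x hx _) ?_ ?_ ?_ ?_
  · exact (real_inner_le_norm _ _).trans (mul_le_mul_of_nonneg_right (hHL _) (norm_nonneg _))
  · refine (real_inner_le_norm _ _).trans
      ((mul_le_mul_of_nonneg_right (hHL _) (norm_nonneg _)).trans_eq ?_)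
    rw [mul_assoc, pow_two]
    rfl
  · refine (real_inner_le_norm _ _).trans (mul_le_mul hs ?_ (norm_nonneg _)
      ((norm_nonneg _).trans hs))
    rw [pow_two]
    exact Matrix.frobenius_norm_mul _ _
  · exact (real_inner_le_norm _ _).trans (mul_le_mul (hf.norm_gradient_le_Lhat hx)
      (Matrix.frobenius_norm_mul _ _) (norm_nonneg _) (L.2.trans (le_Lhat (f := f) (ε := ε))))

theorem rho_mul_norm_landingField_sq_le (hf : IsSmoothObjective f L) (hε : 0 < ε)
    (hε' : ε < 3 / 4) (hlam : 0 < lam) (hγ : gammaMin f L ε lam ≤ γ)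
    {x : Matrix (Fin d) (Fin r) ℝ} (hx : x ∈ safeRegion d r ε) (hρ : 0 ≤ rho γ lam ε) :
    rho γ lam ε * ‖landingField f lam x‖ ^ 2 ≤ ⟪∇ (merit f γ) x, landingField f lam x⟫ := by
  refine le_trans ?_ (le_inner_gradient_merit_landingField hf hε hε' hlam hγ hx)
  rw [norm_landingField_sq, mul_add]
  have h1 : rho γ lam ε ≤ 1 / 2 := min_le_left _ _
  have h2 : rho γ lam ε ≤ γ / (4 * lam * (1 + ε)) := min_le_right _ _
  refine add_le_add (mul_le_mul_of_nonneg_right h1 (sq_nonneg _)) ?_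
  have h3 := norm_mul_sq_le x hx (xᵀ * x - 1)
  calc rho γ lam ε * (lam ^ 2 * ‖x * (xᵀ * x - 1)‖ ^ 2)
      ≤ rho γ lam ε * (lam ^ 2 * ((1 + ε) * ‖xᵀ * x - 1‖ ^ 2)) := by gcongr
    _ ≤ γ / (4 * lam * (1 + ε)) * (lam ^ 2 * ((1 + ε) * ‖xᵀ * x - 1‖ ^ 2)) := by gcongr
    _ = γ * lam / 4 * ‖xᵀ * x - 1‖ ^ 2 := by
      have : 0 < 1 + ε := by linarith
      field_simp

end Descent

/-! ### One landing step: feasibility, merit decrease, and a lower bound on the Lipschitz constant.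
-/

section Step

variable {d r : ℕ} {f : Matrix (Fin d) (Fin r) ℝ → ℝ} {L : ℝ≥0} {γ lam ε a G ν : ℝ}

theorem gram_landing_step (x : Matrix (Fin d) (Fin r) ℝ) (a : ℝ) :
    (x - a • landingField f lam x)ᵀ * (x - a • landingField f lam x) - 1 =
      (1 - 2 * a * lam) • (xᵀ * x - 1) - (2 * a * lam) • ((xᵀ * x - 1) * (xᵀ * x - 1))
        + a ^ 2 • ((landingField f lam x)ᵀ * landingField f lam x) := by
  have h := transpose_mul_landingField_add (f := f) (lam := lam) x
  have e : (x - a • landingField f lam x)ᵀ * (x - a • landingField f lam x) - 1 =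
      (xᵀ * x - 1) - a • (xᵀ * landingField f lam x + (landingField f lam x)ᵀ * x)
        + a ^ 2 • ((landingField f lam x)ᵀ * landingField f lam x) := by
    simp only [Matrix.transpose_sub, Matrix.transpose_smul, Matrix.sub_mul, Matrix.mul_sub,
      Matrix.smul_mul, Matrix.mul_smul]
    module
  rw [e, h]
  module

theorem norm_gram_landing_step_le {x : Matrix (Fin d) (Fin r) ℝ} (hlam : 0 ≤ lam) (ha : 0 ≤ a)
    (ha' : 2 * a * lam ≤ 1) (hx : ‖xᵀ * x - 1‖ ≤ ε) :
    ‖(x - a • landingField f lam x)ᵀ * (x - a • landingField f lam x) - 1‖ ≤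
      (1 - 2 * a * lam) * ‖xᵀ * x - 1‖ + 2 * a * lam * ‖xᵀ * x - 1‖ ^ 2
        + a ^ 2 * (‖relGrad f x‖ ^ 2 + lam ^ 2 * ((1 + ε) * ‖xᵀ * x - 1‖ ^ 2)) := by
  rw [gram_landing_step]
  refine (norm_add_le _ _).trans (add_le_add ((norm_sub_le _ _).trans (add_le_add ?_ ?_)) ?_)
  · rw [norm_smul, Real.norm_of_nonneg (by linarith)]
  · rw [norm_smul, Real.norm_of_nonneg (by positivity), pow_two]
    gcongr
    exact Matrix.frobenius_norm_mul _ _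
  · rw [norm_smul, Real.norm_of_nonneg (by positivity)]
    gcongr
    refine (Matrix.frobenius_norm_mul _ _).trans ?_
    rw [Matrix.frobenius_norm_transpose, ← pow_two, norm_landingField_sq]
    gcongr
    exact norm_mul_sq_le x hx _

/-- The level `ν` is kept general: the condition on `ν(1 - ν)` holds at `ν = ε` and at every `ν` in
`[1/4, ε]`. The first gives invariance of the safety region, the second monotonicity of `max n
(1/4)`. -/
theorem landing_step_scalar_le {n : ℝ} (hlam : 0 < lam) (ha : 0 ≤ a)
    (ha' : 2 * a * lam ≤ 1) (hε : 0 < ε)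
    (haG : a * (G ^ 2 + lam ^ 2 * (1 + ε) * ε ^ 2) ≤ lam * ε * (1 - ε))
    (hn : 0 ≤ n) (hnν : n ≤ ν) (hνε : ν ≤ ε) (hν : ε * (1 - ε) ≤ 2 * (ν * (1 - ν))) :
    (1 - 2 * a * lam) * n + 2 * a * lam * n ^ 2 + a ^ 2 * (G ^ 2 + lam ^ 2 * ((1 + ε) * n ^ 2))
      ≤ ν := by
  have h2 : n ^ 2 ≤ ν ^ 2 := pow_le_pow_left₀ hn hnν 2
  have h3 : n ^ 2 ≤ ε ^ 2 := pow_le_pow_left₀ hn (hnν.trans hνε) 2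
  calc _ ≤ (1 - 2 * a * lam) * ν + 2 * a * lam * ν ^ 2
        + a ^ 2 * (G ^ 2 + lam ^ 2 * ((1 + ε) * ε ^ 2)) := by
        have : 0 ≤ 1 - 2 * a * lam := by linarith
        gcongr
    _ = ν - a * (lam * (2 * (ν * (1 - ν)))) + a * (a * (G ^ 2 + lam ^ 2 * (1 + ε) * ε ^ 2)) := by ring
    _ ≤ ν - a * (lam * (ε * (1 - ε))) + a * (lam * ε * (1 - ε)) := by gcongr
    _ = ν := by ring

theorem norm_gram_landing_step_le_of_le {x : Matrix (Fin d) (Fin r) ℝ} (hlam : 0 < lam)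
    (ha : 0 ≤ a) (ha' : 2 * a * lam ≤ 1) (hε : 0 < ε)
    (haG : a * (G ^ 2 + lam ^ 2 * (1 + ε) * ε ^ 2) ≤ lam * ε * (1 - ε))
    (hG : ‖relGrad f x‖ ≤ G) (hx : ‖xᵀ * x - 1‖ ≤ ν) (hνε : ν ≤ ε)
    (hν : ε * (1 - ε) ≤ 2 * (ν * (1 - ν))) :
    ‖(x - a • landingField f lam x)ᵀ * (x - a • landingField f lam x) - 1‖ ≤ ν := by
  refine (norm_gram_landing_step_le hlam.le ha ha' (hx.trans hνε)).trans
    (le_trans ?_ (landing_step_scalar_le hlam ha ha' hε haG (norm_nonneg _) hx hνε hν))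
  gcongr

theorem alphaSafe_bounds (hlam : 0 < lam) (hε : 0 < ε) (hG : 0 < G) (ha : a ≤ alphaSafe lam ε G) :
    2 * a * lam ≤ 1 ∧ a * (G ^ 2 + lam ^ 2 * (1 + ε) * ε ^ 2) ≤ lam * ε * (1 - ε) := by
  constructor
  · have h := ha.trans ((min_le_right _ _).trans (min_le_right _ _))
    rw [le_div_iff₀ (by positivity)] at h
    linarith
  · have h := ha.trans (min_le_left _ _)
    rwa [le_div_iff₀ (by positivity)] at h

theorem landing_step_mem_safeRegion {x : Matrix (Fin d) (Fin r) ℝ} (hlam : 0 < lam)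
    (ha : 0 ≤ a) (hε : 0 < ε) (hε' : ε < 3 / 4) (hG : 0 < G) (haG : a ≤ alphaSafe lam ε G)
    (hxG : ‖relGrad f x‖ ≤ G) (hx : x ∈ safeRegion d r ε) :
    x - a • landingField f lam x ∈ safeRegion d r ε := by
  obtain ⟨h1, h2⟩ := alphaSafe_bounds hlam hε hG haG
  refine norm_gram_landing_step_le_of_le hlam ha h1 hε h2 hxG hx le_rfl ?_
  nlinarith

theorem max_norm_gram_landing_step_le {x : Matrix (Fin d) (Fin r) ℝ} (hlam : 0 < lam)
    (ha : 0 ≤ a) (hε : 0 < ε) (hε' : ε < 3 / 4) (hG : 0 < G) (haG : a ≤ alphaSafe lam ε G)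
    (hxG : ‖relGrad f x‖ ≤ G) (hx : x ∈ safeRegion d r ε) :
    max ‖(x - a • landingField f lam x)ᵀ * (x - a • landingField f lam x) - 1‖ (1 / 4) ≤
      max ‖xᵀ * x - 1‖ (1 / 4) := by
  refine max_le ?_ (le_max_right _ _)
  rcases le_or_gt ε (1 / 4) with h | h
  · exact le_max_of_le_right ((landing_step_mem_safeRegion hlam ha hε hε' hG haG hxG hx).trans h)
  · obtain ⟨h1, h2⟩ := alphaSafe_bounds hlam hε hG haG
    have h3 : max ‖xᵀ * x - 1‖ (1 / 4) ≤ ε := max_le hx h.le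
    have h4 : 1 / 4 ≤ max ‖xᵀ * x - 1‖ (1 / 4) := le_max_right _ _
    refine norm_gram_landing_step_le_of_le hlam ha h1 hε h2 hxG (le_max_left _ _) h3 ?_
    -- Here `2ν(1 - ν) ≥ 3/8` on `[1/4, 3/4]`, while `ε(1 - ε) ≤ 1/4`.
    nlinarith [sq_nonneg (ε - 1 / 2)]

theorem merit_landing_step_le (hf : IsSmoothObjective f L) (hε : 0 < ε)
    (hε' : ε < 3 / 4) (hlam : 0 < lam) (hγ : gammaMin f L ε lam ≤ γ) {LM Lp : ℝ}
    (hLM : SmoothOn (merit f γ) LM (safeRegion d r ε)) (hLp : LM ≤ Lp)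
    {x : Matrix (Fin d) (Fin r) ℝ} (ha : 0 ≤ a) (haρ : a * Lp ≤ rho γ lam ε)
    (hρ : 0 ≤ rho γ lam ε) (hG : 0 < G) (haG : a ≤ alphaSafe lam ε G)
    (hxG : ‖relGrad f x‖ ≤ G) (hx : x ∈ safeRegion d r ε) :
    merit f γ (x - a • landingField f lam x) ≤
      merit f γ x - a * rho γ lam ε / 2 * ‖landingField f lam x‖ ^ 2 := by
  -- Points of the segment are landing steps with smaller step sizes, which are safe as well.
  have hseg : segment ℝ x (x - a • landingField f lam x) ⊆ safeRegion d r ε := by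
    rw [segment_eq_image']
    rintro _ ⟨t, ht, rfl⟩
    have e : x + t • (x - a • landingField f lam x - x) = x - (t * a) • landingField f lam x := by
      module
    simp only [e]
    exact landing_step_mem_safeRegion hlam (mul_nonneg ht.1 ha) hε hε' hG
      ((mul_le_of_le_one_left ha ht.2).trans haG) hxG hx
  have h := hLM _ _ hseg
  rw [sub_sub_cancel_left, inner_neg_right, inner_smul_right, norm_neg, norm_smul, mul_pow,
    Real.norm_eq_abs, sq_abs] at h
  have h1 := mul_le_mul_of_nonneg_left
    (rho_mul_norm_landingField_sq_le hf hε hε' hlam hγ hx hρ) ha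
  have h2 : LM / 2 * (a ^ 2 * ‖landingField f lam x‖ ^ 2)
      ≤ a * rho γ lam ε / 2 * ‖landingField f lam x‖ ^ 2 := by
    calc LM / 2 * (a ^ 2 * ‖landingField f lam x‖ ^ 2)
        ≤ Lp / 2 * (a ^ 2 * ‖landingField f lam x‖ ^ 2) := by gcongr
      _ = a * Lp * (a / 2 * ‖landingField f lam x‖ ^ 2) := by ring
      _ ≤ rho γ lam ε * (a / 2 * ‖landingField f lam x‖ ^ 2) := by gcongr
      _ = _ := by ring
  linarith

/-- Along the ray through a nonzero Stiefel point the landing field has slope at least `2 lam`. -/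
theorem two_mul_le_of_lipschitzOn {K : ℝ≥0} (hε : 0 < ε) (hlam : 0 < lam)
    (hK : LipschitzOnWith K (landingField f lam) (safeRegion d r ε))
    {z : Matrix (Fin d) (Fin r) ℝ} (hz : zᵀ * z = 1) (hz0 : z ≠ 0) : 2 * lam ≤ K := by
  have hn : 0 < ‖z‖ := norm_pos_iff.2 hz0
  obtain ⟨N, hN⟩ : ∃ N, N = ‖(1 : Matrix (Fin r) (Fin r) ℝ)‖ := ⟨_, rfl⟩
  have hN0 : 0 ≤ N := hN ▸ norm_nonneg _
  obtain ⟨t, ht0, ht⟩ : ∃ t : ℝ, 0 < t ∧ (2 * t + t ^ 2) * N ≤ ε := by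
    refine ⟨min 1 (ε / (3 * (N + 1))), lt_min one_pos (by positivity), ?_⟩
    have h1 : min 1 (ε / (3 * (N + 1))) ≤ 1 := min_le_left _ _
    have h2 : min 1 (ε / (3 * (N + 1))) ≤ ε / (3 * (N + 1)) := min_le_right _ _
    have h3 : 0 < min 1 (ε / (3 * (N + 1))) := lt_min one_pos (by positivity)
    rw [le_div_iff₀ (by positivity)] at h2
    nlinarith
  have hgram : ((1 + t) • z)ᵀ * ((1 + t) • z) - 1 =
      (2 * t + t ^ 2) • (1 : Matrix (Fin r) (Fin r) ℝ) := by
    rw [Matrix.transpose_smul, Matrix.smul_mul, Matrix.mul_smul, hz]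
    module
  have hzs : z ∈ safeRegion d r ε := by
    change ‖zᵀ * z - 1‖ ≤ ε
    rw [hz, sub_self, norm_zero]
    exact hε.le
  have hts : (1 + t) • z ∈ safeRegion d r ε := by
    change ‖((1 + t) • z)ᵀ * ((1 + t) • z) - 1‖ ≤ ε
    rw [hgram, norm_smul, ← hN, Real.norm_of_nonneg (by positivity)]
    exact ht
  have h := hK.dist_le_mul _ hts _ hzs
  rw [dist_eq_norm, dist_eq_norm] at h
  have e1 : (1 + t) • z - z = t • z := by module
  rw [e1, norm_smul, Real.norm_of_nonneg ht0.le] at h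
  have hrel : ∀ w : Matrix (Fin d) (Fin r) ℝ, ⟪relGrad f w, w⟫ = 0 := fun w => by
    have := inner_skew_mul_symm (skewPart_transpose (∇ f w * wᵀ))
      (Matrix.transpose_one (n := Fin r) (α := ℝ)) w
    rwa [Matrix.mul_one] at this
  have hrel2 : ⟪relGrad f ((1 + t) • z), z⟫ = 0 := by
    have := hrel ((1 + t) • z)
    rw [inner_smul_right] at this
    exact (mul_eq_zero.1 this).resolve_left (by positivity)
  have h2 : ⟪landingField f lam ((1 + t) • z) - landingField f lam z, z⟫
      = lam * ((1 + t) * (2 * t + t ^ 2)) * ‖z‖ ^ 2 := by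
    rw [inner_sub_left, landingField, landingField, inner_add_left, inner_add_left, hrel, hrel2,
      hgram, hz, sub_self, Matrix.mul_zero, smul_zero, inner_zero_left, Matrix.mul_smul,
      Matrix.mul_one, smul_smul, smul_smul, inner_smul_left, real_inner_self_eq_norm_sq]
    simp only [conj_trivial]
    ring
  have h3 := real_inner_le_norm (landingField f lam ((1 + t) • z) - landingField f lam z) z
  rw [h2] at h3
  have h4 := mul_le_mul_of_nonneg_right h hn.le
  have h5 : 2 * lam * (t * ‖z‖ ^ 2) ≤ K * (t * ‖z‖ ^ 2) := by
    have : 2 * lam * (t * ‖z‖ ^ 2) ≤ lam * ((1 + t) * (2 * t + t ^ 2)) * ‖z‖ ^ 2 := by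
      have : 0 ≤ lam * (3 * t ^ 2 + t ^ 3) * ‖z‖ ^ 2 := by positivity
      linarith
    linarith
  exact le_of_mul_le_mul_right h5 (by positivity)

end Step

/-! ### Scalar inequalities behind the gradient domination. -/

section PolyakLojasiewicz

/-- Expanded in the distances `A`, `B` to the endpoints of the interval, homogenized by `A + B =
1/2`, the difference has only positive coefficients (Bernstein form). -/
theorem gradient_dominates_poly {n : ℝ} (h1 : 1 / 4 ≤ n) (h2 : n ≤ 3 / 4) :
    50 * ((1 - n) * (6 + 17 * n + 5 * n ^ 2) ^ 2) ≤
      9 * (21 - 17 * n) ^ 2 * ((1 + n) ^ 2 * (1 - n) + n ^ 2 * (3 + 2 * n) ^ 2) := by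
  obtain ⟨A, hA⟩ : ∃ A, A = n - 1 / 4 := ⟨_, rfl⟩
  obtain ⟨B, hB⟩ : ∃ B, B = 3 / 4 - n := ⟨_, rfl⟩
  have hA0 : 0 ≤ A := by linarith
  have hB0 : 0 ≤ B := by linarith
  have key : 9 * (21 - 17 * n) ^ 2 * ((1 + n) ^ 2 * (1 - n) + n ^ 2 * (3 + 2 * n) ^ 2)
      - 50 * ((1 - n) * (6 + 17 * n + 5 * n ^ 2) ^ 2) = 362787 / 8 * B ^ 6
        + 1834841 / 8 * (A * B ^ 5) + 2810561 / 4 * (A ^ 2 * B ^ 4) + 5148689 / 4 * (A ^ 3 * B ^ 3)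
        + 9694343 / 8 * (A ^ 4 * B ^ 2) + 4299765 / 8 * (A ^ 5 * B) + 209241 / 2 * A ^ 6 := by
    rw [hA, hB]
    ring
  have : 0 ≤ 362787 / 8 * B ^ 6
        + 1834841 / 8 * (A * B ^ 5) + 2810561 / 4 * (A ^ 2 * B ^ 4) + 5148689 / 4 * (A ^ 3 * B ^ 3)
        + 9694343 / 8 * (A ^ 4 * B ^ 2) + 4299765 / 8 * (A ^ 5 * B) + 209241 / 2 * A ^ 6 := by
    positivity
  linarith

theorem gradient_dominates_monotone_poly {n : ℝ} (h1 : 1 / 4 ≤ n) (h2 : n ≤ 3 / 4) :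
    0 ≤ 600 * (n * (11 + 5 * n)) + (1800 - 9 * (21 - 17 * n) ^ 2) * (2 * (1 + n)) := by
  obtain ⟨A, hA⟩ : ∃ A, A = n - 1 / 4 := ⟨_, rfl⟩
  have hA0 : 0 ≤ A := by linarith
  have hA1 : A ≤ 1 / 2 := by linarith
  have e : n = A + 1 / 4 := by linarith
  rw [e]
  nlinarith [mul_nonneg hA0 (sub_nonneg.2 hA1), mul_nonneg (mul_nonneg hA0 hA0) (sub_nonneg.2 hA1)]

/-- The right side minus the left side is compared with its value at the extreme `g = (1 + n)h`,
where `gradient_dominates_poly` applies. The change is `(1 - n)` times `(1 + n)h - g` times the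
bracket in `hbr`. -/
theorem gradient_dominates_core {n h g : ℝ} (h1 : 1 / 4 ≤ n) (h2 : n ≤ 3 / 4) (hh : 0 ≤ h)
    (hg : 0 ≤ g) (hgh : g ≤ (1 + n) * h) :
    50 * ((1 - n) * (6 * g + n * (11 + 5 * n) * h) ^ 2) ≤
      9 * (21 - 17 * n) ^ 2 * (g ^ 2 * (1 - n) + n ^ 2 * (3 + 2 * n) ^ 2 * h ^ 2) := by
  obtain ⟨q, hq⟩ : ∃ q, q = (1 + n) * h - g := ⟨_, rfl⟩
  have hq0 : 0 ≤ q := by linarith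
  have hend := mul_le_mul_of_nonneg_right (gradient_dominates_poly h1 h2) (sq_nonneg h)
  have hbr : 0 ≤ 600 * (n * (11 + 5 * n)) * h
      + (1800 - 9 * (21 - 17 * n) ^ 2) * ((1 + n) * h + g) := by
    rcases le_or_gt 0 (1800 - 9 * (21 - 17 * n) ^ 2) with hc | hc
    · have : 0 ≤ n := by linarith
      positivity
    · have h3 := mul_nonneg (gradient_dominates_monotone_poly h1 h2) hh
      have h4 : (1800 - 9 * (21 - 17 * n) ^ 2) * (2 * (1 + n) * h)
          ≤ (1800 - 9 * (21 - 17 * n) ^ 2) * ((1 + n) * h + g) :=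
        mul_le_mul_of_nonpos_left (by linarith) hc.le
      linarith
  have h5 := mul_nonneg (mul_nonneg (by linarith : 0 ≤ 1 - n) hq0) hbr
  rw [hq] at h5
  linarith

theorem gradient_dominates_core_of_le {n h g : ℝ} (h1 : 0 ≤ n) (h2 : n ≤ 1 / 4) (hh : 0 ≤ h)
    (hg : 0 ≤ g) :
    50 * ((1 - n) * (6 * g + n * (11 + 5 * n) * h) ^ 2) ≤
      9 * (21 - 17 * (1 / 4)) ^ 2 * (g ^ 2 * (1 - n) + n ^ 2 * (3 + 2 * n) ^ 2 * h ^ 2) := by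
  obtain ⟨V, hV⟩ : ∃ V, V = n * (3 + 2 * n) * h := ⟨_, rfl⟩
  have hV0 : 0 ≤ V := by rw [hV]; positivity
  have h3 : n * (11 + 5 * n) * h ≤ 11 / 3 * V := by
    rw [hV]
    have : 0 ≤ n * n * h := by positivity
    linarith
  have h4 : (6 * g + n * (11 + 5 * n) * h) ^ 2 ≤ (6 * g + 11 / 3 * V) ^ 2 :=
    pow_le_pow_left₀ (by positivity) (by linarith) 2
  -- Cauchy-Schwarz, as `6² + (11/3)² = 445/9 < 50`.
  have h5 : (6 * g + 11 / 3 * V) ^ 2 ≤ 50 * (g ^ 2 + V ^ 2) := by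
    nlinarith [sq_nonneg (11 / 3 * g - 6 * V), sq_nonneg g, sq_nonneg V]
  have h6 := mul_le_mul_of_nonneg_left (h4.trans h5) (by linarith : 0 ≤ 1 - n)
  have h7 : n ^ 2 * (3 + 2 * n) ^ 2 * h ^ 2 = V ^ 2 := by rw [hV]; ring
  rw [h7]
  nlinarith [mul_nonneg h1 (sq_nonneg V), mul_nonneg (by linarith : 0 ≤ 1 - n) (sq_nonneg g),
    sq_nonneg V]

/-- A constant `κ(n)` with `μ' * (merit - fS) ≤ κ(n) ^ 2 * ‖Λ‖ ^ 2` at points with `‖xᵀx - 1‖ = n`.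
It is small enough for `(1 + κ(n)) ^ 2 < 4 * √(1 - n)`. -/
noncomputable def pathFactor (n : ℝ) : ℝ := (21 - 17 * max n (1 / 4)) / 20

theorem pathFactor_pos {n : ℝ} (h : n ≤ 3 / 4) : 0 < pathFactor n := by
  have : max n (1 / 4) ≤ 3 / 4 := max_le h (by norm_num)
  rw [pathFactor]
  linarith

theorem pathFactor_le (n : ℝ) : pathFactor n ≤ 67 / 80 := by
  have : 1 / 4 ≤ max n (1 / 4) := le_max_right _ _
  rw [pathFactor]
  linarith

/-- Nearly sharp at `n = 3/4`, where the two sides are `1.4125² ≈ 1.995` and `2`. Squaring once more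
gives a quartic in `max n (1/4)`, again settled in Bernstein form. -/
theorem one_add_pathFactor_sq_lt {n : ℝ} (h : n ≤ 3 / 4) :
    (1 + pathFactor n) ^ 2 < 4 * √(1 - n) := by
  have h2 : max n (1 / 4) ≤ 3 / 4 := max_le h (by norm_num)
  have h1 : 1 / 4 ≤ max n (1 / 4) := le_max_right _ _
  have h3 : n ≤ max n (1 / 4) := le_max_left _ _
  rw [pathFactor]
  generalize max n (1 / 4) = t at h1 h2 h3
  have h4 : ((1 + (21 - 17 * t) / 20) ^ 2 / 4) ^ 2 < 1 - t := by
    obtain ⟨A, hA⟩ : ∃ A, A = t - 1 / 4 := ⟨_, rfl⟩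
    obtain ⟨B, hB⟩ : ∃ B, B = 3 / 4 - t := ⟨_, rfl⟩
    have hA0 : 0 ≤ A := by linarith
    have hB0 : 0 ≤ B := by linarith
    have key : 2560000 * (1 - t) - 2560000 * ((1 + (21 - 17 * t) / 20) ^ 2 / 4) ^ 2
      = 24571119 / 16 * B ^ 4 + 50652901 / 4 * (A * B ^ 3) + 155264037 / 8 * (A ^ 2 * B ^ 2)
        + 33654141 / 4 * (A ^ 3 * B) + 792639 / 16 * A ^ 4 := by
      rw [hA, hB]
      ring
    have : 0 < 24571119 / 16 * B ^ 4 + 50652901 / 4 * (A * B ^ 3) + 155264037 / 8 * (A ^ 2 * B ^ 2)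
        + 33654141 / 4 * (A ^ 3 * B) + 792639 / 16 * A ^ 4 := by
      rcases hA0.eq_or_lt with h0 | h0
      · rw [← h0, show B = 1 / 2 by linarith]
        norm_num
      · positivity
    linarith
  have h5 := Real.lt_sqrt_of_sq_lt (h4.trans_le (by linarith : 1 - t ≤ 1 - n))
  linarith

/-- The definition of `μ'` lets the penalty part `M` of `‖Λ‖²` pay for the error of moving the
gradient to the polar factor and for the quadratic merit error. The factor `4/9` is the square of
the `2/3` in the polar distance. -/
theorem gradient_dominates_scalar {n ε h g l M μ μ' lam Lp : ℝ} (hn : 0 ≤ n) (hnε : n ≤ ε)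
    (hε' : ε < 3 / 4) (hh : 0 ≤ h) (hg : 0 ≤ g) (hgh : g ≤ (1 + n) * h) (hμ : 0 < μ)
    (hμ'0 : 0 ≤ μ') (hμ' : μ' ≤ μ) (hLp : 0 ≤ Lp)
    (hμ'' : μ' * (2 * (3 + 2 * ε) ^ 2 * h ^ 2 + μ * Lp) ≤ 2 * μ * lam ^ 2 * (1 - ε) ^ 2)
    (hM : lam ^ 2 * ((1 - n) * n ^ 2) ≤ M)
    (hl : l ≤ 1 / (2 * μ) * (g + (11 + 5 * n) / 6 * h * n) ^ 2 + Lp / 2 * (2 / 3 * n) ^ 2) :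
    μ' * l ≤ pathFactor n ^ 2 * (g ^ 2 + M) := by
  have hn1 : 0 < 1 - n := by linarith
  obtain ⟨w, hw⟩ : ∃ w, w = μ' / μ := ⟨_, rfl⟩
  have hw0 : 0 ≤ w := by rw [hw]; positivity
  have hw1 : w ≤ 1 := by rw [hw]; exact (div_le_one hμ).2 hμ'
  have hwμ : w * μ = μ' := by rw [hw]; field_simp
  obtain ⟨κ, hκ⟩ : ∃ κ, κ = pathFactor n := ⟨_, rfl⟩
  have hcore : 1 / 2 * ((1 - n) * (g + (11 + 5 * n) / 6 * h * n) ^ 2) ≤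
      κ ^ 2 * (g ^ 2 * (1 - n) + n ^ 2 * (3 + 2 * n) ^ 2 * h ^ 2) := by
    rw [hκ, pathFactor]
    rcases le_total n (1 / 4) with h4 | h4
    · rw [max_eq_right h4]
      have := gradient_dominates_core_of_le hn h4 hh hg
      linarith
    · rw [max_eq_left h4]
      have := gradient_dominates_core h4 (by linarith) hh hg hgh
      linarith
  have hκ2 : 4 / 9 * (1 - n) ≤ κ ^ 2 := by
    rw [hκ, pathFactor]
    have h2 : max n (1 / 4) ≤ 3 / 4 := max_le (by linarith) (by norm_num)
    have h1 : 1 / 4 ≤ max n (1 / 4) := le_max_right _ _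
    rcases le_total n (1 / 4) with h4 | h4
    · rw [max_eq_right h4]
      linarith
    · rw [max_eq_left h4]
      nlinarith
  have hA : w * (n ^ 2 * (3 + 2 * n) ^ 2 * h ^ 2) + μ' * Lp / 2 * n ^ 2 ≤ (1 - n) * M := by
    have e1 : w * (3 + 2 * ε) ^ 2 * h ^ 2 + μ' * Lp / 2 ≤ lam ^ 2 * (1 - ε) ^ 2 := by
      refine le_of_mul_le_mul_left ?_ (by positivity : 0 < 2 * μ)
      have : 2 * μ * (w * (3 + 2 * ε) ^ 2 * h ^ 2 + μ' * Lp / 2)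
          = 2 * (w * μ) * (3 + 2 * ε) ^ 2 * h ^ 2 + μ * μ' * Lp := by ring
      rw [this, hwμ]
      linarith
    have e2 : w * ((3 + 2 * n) ^ 2 * h ^ 2) ≤ w * ((3 + 2 * ε) ^ 2 * h ^ 2) := by gcongr
    have e3 : lam ^ 2 * (1 - ε) ^ 2 ≤ lam ^ 2 * (1 - n) ^ 2 := by
      have : 0 ≤ 1 - ε := by linarith
      gcongr
    have e4 := mul_le_mul_of_nonneg_right ((add_le_add_left e2 (μ' * Lp / 2)).trans
      ((by linarith : _ ≤ _).trans (e1.trans e3))) (sq_nonneg n)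
    have e5 := mul_le_mul_of_nonneg_left hM hn1.le
    linarith
  have h1 : μ' * l ≤ w * (1 / 2 * (g + (11 + 5 * n) / 6 * h * n) ^ 2)
      + 4 / 9 * (μ' * Lp / 2 * n ^ 2) := by
    refine (mul_le_mul_of_nonneg_left hl hμ'0).trans_eq ?_
    rw [hw]
    field_simp
    ring
  rw [← hκ]
  refine le_of_mul_le_mul_left ?_ hn1
  have h2 := mul_le_mul_of_nonneg_left h1 hn1.le
  have h3 := mul_le_mul_of_nonneg_left hcore hw0
  have hB0 : 0 ≤ μ' * Lp / 2 * n ^ 2 := by positivity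
  have h4 := mul_le_mul_of_nonneg_right hκ2 hB0
  have h5 := mul_le_mul_of_nonneg_left hA (sq_nonneg κ)
  have h6 : w * (κ ^ 2 * (g ^ 2 * (1 - n))) ≤ κ ^ 2 * (g ^ 2 * (1 - n)) :=
    mul_le_of_le_one_left (by positivity) hw1
  linarith

end PolyakLojasiewicz

/-! ### Comparison of a point with its polar factor, and the Łojasiewicz inequality for the merit
function. -/

section Projection

variable {d r : ℕ} {f : Matrix (Fin d) (Fin r) ℝ → ℝ} {L : ℝ≥0} {γ lam ε : ℝ}

theorem relGrad_eq (x : Matrix (Fin d) (Fin r) ℝ) :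
    relGrad f x = (1 / 2 : ℝ) • (∇ f x * (xᵀ * x) - x * (∇ f x)ᵀ * x) := by
  rw [relGrad, skewPart, Matrix.smul_mul, Matrix.sub_mul, Matrix.transpose_mul,
    Matrix.transpose_transpose, Matrix.mul_assoc (∇ f x)]

theorem norm_relGrad_stiefel_le {Lh : ℝ} {x y : Matrix (Fin d) (Fin r) ℝ} (hL : LipschitzWith L (∇ f))
    (hLh : L ≤ Lh) (hy : yᵀ * y = 1) (hyL : ‖∇ f y‖ ≤ Lh)
    (hxy : ‖x - y‖ ≤ 2 / 3 * ‖xᵀ * x - 1‖) :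
    ‖relGrad f y‖ ≤ ‖relGrad f x‖ + (11 + 5 * ‖xᵀ * x - 1‖) / 6 * Lh * ‖xᵀ * x - 1‖ := by
  obtain ⟨n, hn⟩ : ∃ n, n = ‖xᵀ * x - 1‖ := ⟨_, rfl⟩
  have hxn : ‖xᵀ * x - 1‖ ≤ n := hn.ge
  have hyn : ‖yᵀ * y - 1‖ ≤ 0 := by rw [hy, sub_self, norm_zero]
  rw [← hn] at hxy ⊢
  have hn0 : 0 ≤ n := hn ▸ norm_nonneg _
  have hLh0 : 0 ≤ Lh := L.2.trans hLh
  obtain ⟨q, hq⟩ : ∃ q, q = ‖x - y‖ := ⟨_, rfl⟩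
  rw [← hq] at hxy
  have hq0 : 0 ≤ q := hq ▸ norm_nonneg _
  have hab : ‖∇ f x - ∇ f y‖ ≤ Lh * q := by
    have := hL.dist_le_mul x y
    rw [dist_eq_norm, dist_eq_norm, ← hq] at this
    exact this.trans (by gcongr)
  have e : relGrad f x - relGrad f y = (1 / 2 : ℝ) • ((∇ f x - ∇ f y) * xᵀ * x
      + ∇ f y * (xᵀ * x - 1) - x * (∇ f x - ∇ f y)ᵀ * x - (x - y) * (∇ f y)ᵀ * x
      - y * ((∇ f y)ᵀ * (x - y))) := by
    rw [relGrad_eq, relGrad_eq, hy, ← smul_sub]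
    congr 1
    simp only [Matrix.transpose_sub, Matrix.sub_mul, Matrix.mul_sub, Matrix.mul_one,
      Matrix.mul_assoc]
    abel
  have hs : √(1 + n) * √(1 + n) = 1 + n := Real.mul_self_sqrt (by linarith)
  have hs2 : √(1 + n) ≤ 1 + n / 2 := by
    rw [Real.sqrt_le_left (by linarith)]
    nlinarith [sq_nonneg n]
  have t1 : ‖(∇ f x - ∇ f y) * xᵀ * x‖ ≤ (1 + n) * (Lh * q) := by
    calc _ ≤ √(1 + n) * (√(1 + n) * ‖∇ f x - ∇ f y‖) :=
        (norm_mul_base_le_sqrt x hxn _).trans (by gcongr; exact norm_mul_transpose_le_sqrt x hxn _)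
      _ = (1 + n) * ‖∇ f x - ∇ f y‖ := by rw [← mul_assoc, hs]
      _ ≤ _ := by gcongr
  have t2 : ‖∇ f y * (xᵀ * x - 1)‖ ≤ Lh * n := by
    refine (Matrix.frobenius_norm_mul _ _).trans ?_
    rw [← hn]
    gcongr
  have t3 : ‖x * (∇ f x - ∇ f y)ᵀ * x‖ ≤ (1 + n) * (Lh * q) := by
    calc _ ≤ √(1 + n) * (√(1 + n) * ‖(∇ f x - ∇ f y)ᵀ‖) :=
        (norm_mul_base_le_sqrt x hxn _).trans (by gcongr; exact norm_mul_le_sqrt x hxn _)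
      _ = (1 + n) * ‖∇ f x - ∇ f y‖ := by rw [← mul_assoc, hs, Matrix.frobenius_norm_transpose]
      _ ≤ _ := by gcongr
  have t4 : ‖(x - y) * (∇ f y)ᵀ * x‖ ≤ (1 + n / 2) * (q * Lh) := by
    refine (norm_mul_base_le_sqrt x hxn _).trans ?_
    gcongr
    refine (Matrix.frobenius_norm_mul _ _).trans ?_
    rw [← hq, Matrix.frobenius_norm_transpose]
    gcongr
  have t5 : ‖y * ((∇ f y)ᵀ * (x - y))‖ ≤ Lh * q := by
    rw [norm_mul_of_stiefel hy]
    refine (Matrix.frobenius_norm_mul _ _).trans ?_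
    rw [← hq, Matrix.frobenius_norm_transpose]
    gcongr
  have h1 : ‖relGrad f x - relGrad f y‖ ≤ 1 / 2 * ((1 + n) * (Lh * q) + Lh * n
      + (1 + n) * (Lh * q) + (1 + n / 2) * (q * Lh) + Lh * q) := by
    rw [e, norm_smul, Real.norm_of_nonneg (by norm_num)]
    refine mul_le_mul_of_nonneg_left ?_ (by norm_num)
    exact (norm_sub_le _ _).trans (add_le_add ((norm_sub_le _ _).trans (add_le_add
      ((norm_sub_le _ _).trans (add_le_add ((norm_add_le _ _).trans (add_le_add t1 t2)) t3)) t4)) t5)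
  have h2 := norm_le_norm_add_norm_sub (relGrad f x) (relGrad f y)
  -- The five terms add up to `(4 + 5n/2) Lh q + Lh n`; inserting `q ≤ 2n/3` and halving gives `(11
  -- + 5n)/6 · Lh n`.
  have h3 : (4 + 5 / 2 * n) * (Lh * q) ≤ (4 + 5 / 2 * n) * (Lh * (2 / 3 * n)) := by gcongr
  linarith

/-- The normal derivative of `f` is cancelled by that of the correction term. This is why the merit
exceeds `f(y)` only quadratically in `merit_le_of_normal`. -/
theorem inner_gradient_merit_stiefel (hf : IsSmoothObjective f L) {y : Matrix (Fin d) (Fin r) ℝ}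
    (hy : yᵀ * y = 1) {E : Matrix (Fin r) (Fin r) ℝ} (hE : Eᵀ = E) :
    ⟪∇ (merit f γ) y, y * E⟫ = 0 := by
  obtain ⟨H, -, hH⟩ := exists_inner_gradient_merit (γ := γ) hf y
  have e : yᵀ * (y * E) + (y * E)ᵀ * y = (2 : ℝ) • E := by
    rw [Matrix.transpose_mul, hE, Matrix.mul_assoc, hy, ← Matrix.mul_assoc, hy, Matrix.one_mul,
      Matrix.mul_one, two_smul]
  rw [hH, e, hy, sub_self, Matrix.mul_zero, Matrix.mul_zero, inner_zero_right, inner_zero_left,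
    Matrix.mul_smul, add_zero, inner_smul_right]
  ring

theorem merit_le_of_normal (hf : IsSmoothObjective f L) {LM Lp n : ℝ}
    (hLM : SmoothOn (merit f γ) LM (safeRegion d r ε)) (hLp : LM ≤ Lp) (hLp0 : 0 ≤ Lp)
    {x y : Matrix (Fin d) (Fin r) ℝ} {E : Matrix (Fin r) (Fin r) ℝ} (hy : yᵀ * y = 1)
    (hE : Eᵀ = E) (hxy : x - y = y * E) (hq : ‖x - y‖ ≤ n)
    (hseg : ∀ t : ℝ, 0 ≤ t → t ≤ 1 → ‖(1 + t • E) * (1 + t • E) - 1‖ ≤ ε) :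
    merit f γ x ≤ f y + Lp / 2 * n ^ 2 := by
  have h := hLM y x (by
    rw [segment_eq_image']
    rintro _ ⟨t, ht, rfl⟩
    have e : (y + t • (x - y))ᵀ * (y + t • (x - y)) = (1 + t • E) * (1 + t • E) := by
      rw [hxy, show y + t • (y * E) = y * (1 + t • E) by
        rw [Matrix.mul_add, Matrix.mul_one, Matrix.mul_smul], Matrix.transpose_mul,
        Matrix.mul_assoc, ← Matrix.mul_assoc yᵀ, hy, Matrix.one_mul, Matrix.transpose_add,
        Matrix.transpose_one, Matrix.transpose_smul, hE]
    change ‖(y + t • (x - y))ᵀ * (y + t • (x - y)) - 1‖ ≤ ε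
    rw [e]
    exact hseg t ht.1 ht.2)
  rw [merit_of_stiefel hy, hxy, inner_gradient_merit_stiefel hf hy hE, ← hxy, add_zero] at h
  refine h.trans ?_
  gcongr

/-- The quadratic upper bound for `f` at `x` involves `⟨sym(xᵀ∇f), R⟩`, the merit involves the same
with `D/2`. Since `R` and `D/2` differ to second order, `γ p` dominates the difference. -/
theorem le_merit_of_polar (hf : IsSmoothObjective f L) (hε' : ε < 3 / 4)
    (hlam : 0 < lam) (hγ : gammaMin f L ε lam ≤ γ) {x y : Matrix (Fin d) (Fin r) ℝ}
    {R : Matrix (Fin r) (Fin r) ℝ} (hx : x ∈ safeRegion d r ε) (hR : Rᵀ = R) (hxy : x - y = x * R)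
    (hq : (3 - 4 * ε) * ‖x - y‖ ^ 2 ≤ (1 - ε) * ‖xᵀ * x - 1‖ ^ 2)
    (hRD : (3 - 4 * ε) * ‖R - (1 / 2 : ℝ) • (xᵀ * x - 1)‖ ≤ 3 / 2 * ‖xᵀ * x - 1‖ ^ 2) :
    f y ≤ merit f γ x := by
  have h1ε : 0 < 1 - ε := by linarith
  have h3ε : 0 < 3 - 4 * ε := by linarith
  have h1 := le_quadratic_of_lipschitz_gradient hf.differentiable hf.2 x y
  have h2 : ⟪∇ f x, y - x⟫ = - ⟪symPart (xᵀ * ∇ f x), R⟫ := by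
    rw [← neg_sub x y, inner_neg_right, hxy, inner_gradient_mul x hR]
  rw [h2, norm_sub_rev] at h1
  have h3 : ⟪symPart (xᵀ * ∇ f x), R⟫ - 1 / 2 * ⟪symPart (xᵀ * ∇ f x), xᵀ * x - 1⟫
      = ⟪symPart (xᵀ * ∇ f x), R - (1 / 2 : ℝ) • (xᵀ * x - 1)⟫ := by
    rw [← inner_smul_right, ← inner_sub_right]
  have hs : ‖symPart (xᵀ * ∇ f x)‖ ≤ symSup f ε := hf.norm_symPart_le_symSup hx
  have hs0 : 0 ≤ symSup f ε := (norm_nonneg _).trans hs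
  have h4 := (abs_le.1 ((abs_real_inner_le_norm (symPart (xᵀ * ∇ f x))
    (R - (1 / 2 : ℝ) • (xᵀ * x - 1))).trans (mul_le_mul_of_nonneg_right hs (norm_nonneg _)))).1
  rw [merit_eq, inner_gradient_mul x (gram_sub_one_transpose x)]
  have h5 := le_mul_of_gammaMin_le hε' hγ
  have h6 : 0 ≤ Lhat f L ε ^ 2 * ((1 + ε) ^ 2 / (lam * (1 - ε))) := by positivity
  have h7 : L / 2 * ‖x - y‖ ^ 2 + symSup f ε * ‖R - (1 / 2 : ℝ) • (xᵀ * x - 1)‖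
      ≤ γ / 4 * ‖xᵀ * x - 1‖ ^ 2 := by
    refine le_of_mul_le_mul_left ?_ h3ε
    have h8 := mul_le_mul_of_nonneg_left hq (by positivity : 0 ≤ (L : ℝ) / 2)
    have h9 := mul_le_mul_of_nonneg_left hRD hs0
    have h10 := mul_le_mul_of_nonneg_right h5 (by positivity : 0 ≤ 1 / 2 * ‖xᵀ * x - 1‖ ^ 2)
    have h11 := mul_nonneg h6 (by positivity : 0 ≤ 1 / 2 * ‖xᵀ * x - 1‖ ^ 2)
    linarith
  linarith

/-- The comparison point on the Stiefel manifold of a point in the safety region. -/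
theorem exists_stiefel_comparison (hf : IsSmoothObjective f L) (hε' : ε < 3 / 4)
    (hlam : 0 < lam) (hγ : gammaMin f L ε lam ≤ γ) {LM Lp : ℝ}
    (hLM : SmoothOn (merit f γ) LM (safeRegion d r ε)) (hLp : LM ≤ Lp) (hLp0 : 0 ≤ Lp)
    {x : Matrix (Fin d) (Fin r) ℝ} (hx : x ∈ safeRegion d r ε) :
    ∃ y ∈ stiefel d r,
      (∀ z ∈ stiefel d r, √(1 - ‖xᵀ * x - 1‖) * ‖y - z‖ ^ 2 ≤ ‖x - z‖ ^ 2) ∧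
      merit f γ x ≤ f y + Lp / 2 * (2 / 3 * ‖xᵀ * x - 1‖) ^ 2 ∧
      ‖relGrad f y‖ ≤ ‖relGrad f x‖
        + (11 + 5 * ‖xᵀ * x - 1‖) / 6 * Lhat f L ε * ‖xᵀ * x - 1‖ ∧
      f y ≤ merit f γ x := by
  obtain ⟨y, E, R, hy, hE, hR, hyE, hxR, hq, hq2, hseg, hpsd, hRD⟩ := exists_polar hε' x hx
  have hε0 : 0 ≤ ε := (norm_nonneg _).trans hx
  have hys : y ∈ safeRegion d r ε := by
    change ‖yᵀ * y - 1‖ ≤ ε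
    rwa [hy, sub_self, norm_zero]
  exact ⟨y, hy, fun z hz => sqrt_mul_norm_sub_sq_le hy hz hE hyE hpsd,
    merit_le_of_normal hf hLM hLp hLp0 hy hE hyE hq fun t ht ht' => (hseg t ht ht').trans hx,
    norm_relGrad_stiefel_le hf.2 le_Lhat hy (hf.norm_gradient_le_Lhat hys) hq,
    le_merit_of_polar hf hε' hlam hγ hx hR hxR hq2 hRD⟩

theorem muPrime_pos {μ Lh Lp : ℝ} (hμ : 0 < μ) : 0 < muPrime μ lam ε Lh Lp :=
  one_div_pos.2 (lt_max_of_lt_left (one_div_pos.2 hμ))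

theorem muPrime_le {μ Lh Lp : ℝ} (hμ : 0 < μ) : muPrime μ lam ε Lh Lp ≤ μ := by
  rw [muPrime]
  exact (one_div_le_one_div_of_le (one_div_pos.2 hμ) (le_max_left _ _)).trans_eq (one_div_one_div μ)

theorem muPrime_mul_le {μ Lh Lp : ℝ} (hμ : 0 < μ) (hlam : 0 < lam) (hε : ε < 1) :
    muPrime μ lam ε Lh Lp * (2 * (3 + 2 * ε) ^ 2 * Lh ^ 2 + μ * Lp)
      ≤ 2 * μ * lam ^ 2 * (1 - ε) ^ 2 := by
  have h1 : 0 < 1 - ε := by linarith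
  have h2 : 0 < 2 * μ * lam ^ 2 * (1 - ε) ^ 2 := by positivity
  have h3 := le_max_right (1 / μ)
    ((2 * (3 + 2 * ε) ^ 2 * Lh ^ 2 + μ * Lp) / (2 * μ * lam ^ 2 * (1 - ε) ^ 2))
  rw [div_le_iff₀ h2] at h3
  have h4 : 0 < max (1 / μ)
      ((2 * (3 + 2 * ε) ^ 2 * Lh ^ 2 + μ * Lp) / (2 * μ * lam ^ 2 * (1 - ε) ^ 2)) :=
    lt_max_of_lt_left (one_div_pos.2 hμ)
  rw [muPrime, one_div_mul_eq_div, div_le_iff₀ h4]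
  linarith

theorem muPrime_mul_merit_le (hf : IsSmoothObjective f L) (hε' : ε < 3 / 4)
    (hlam : 0 < lam) {fS μ δ Lp : ℝ} (hμ : 0 < μ) (hPL : LocalRiemannianPL f fS μ δ)
    (hLp0 : 0 ≤ Lp) {x y : Matrix (Fin d) (Fin r) ℝ} (hx : x ∈ safeRegion d r ε)
    (hy : y ∈ stiefel d r ∩ Metric.cthickening (2 * δ) (localMinima f fS))
    (hxy : merit f γ x ≤ f y + Lp / 2 * (2 / 3 * ‖xᵀ * x - 1‖) ^ 2)
    (hg : ‖relGrad f y‖ ≤ ‖relGrad f x‖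
      + (11 + 5 * ‖xᵀ * x - 1‖) / 6 * Lhat f L ε * ‖xᵀ * x - 1‖) :
    muPrime μ lam ε (Lhat f L ε) Lp * (merit f γ x - fS) ≤
      pathFactor ‖xᵀ * x - 1‖ ^ 2 * ‖landingField f lam x‖ ^ 2 := by
  have hLh : 0 ≤ Lhat f L ε := L.2.trans (le_Lhat (f := f))
  have hgx : ‖relGrad f x‖ ≤ (1 + ‖xᵀ * x - 1‖) * Lhat f L ε :=
    (norm_relGrad_le x le_rfl).trans
      (mul_le_mul_of_nonneg_left (hf.norm_gradient_le_Lhat hx) (by positivity))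
  rw [norm_landingField_sq]
  refine gradient_dominates_scalar (norm_nonneg _) hx hε' hLh (norm_nonneg _) hgx hμ
    (muPrime_pos hμ).le (muPrime_le hμ) hLp0 (muPrime_mul_le hμ hlam (by linarith)) ?_ ?_
  · gcongr
    exact le_norm_mul_sq x le_rfl _
  · have h1 := (le_abs_self _).trans (hPL y hy)
    have h2 : 1 / (2 * μ) * ‖relGrad f y‖ ^ 2 ≤ 1 / (2 * μ) * (‖relGrad f x‖
      + (11 + 5 * ‖xᵀ * x - 1‖) / 6 * Lhat f L ε * ‖xᵀ * x - 1‖) ^ 2 := by gcongr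
    linarith

end Projection

/-! ### Distances to a set and sequences of finite length. -/

section MetricLemmas

variable {X : Type*} [PseudoMetricSpace X] {S : Set X} {x y : X} {δ s : ℝ}

theorem mem_cthickening_iff_infDist_le (hS : S.Nonempty) (hδ : 0 ≤ δ) :
    x ∈ Metric.cthickening δ S ↔ Metric.infDist x S ≤ δ := by
  rw [Metric.mem_cthickening_iff, Metric.infDist,
    ENNReal.le_ofReal_iff_toReal_le (Metric.infEDist_ne_top hS) hδ]

theorem sqrt_mul_infDist_le (hS : S.Nonempty)
    (h : ∀ z ∈ S, s * dist y z ^ 2 ≤ dist x z ^ 2) :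
    √s * Metric.infDist y S ≤ Metric.infDist x S := by
  refine (Metric.le_infDist hS).2 fun z hz => ?_
  refine (mul_le_mul_of_nonneg_left (Metric.infDist_le_dist_of_mem hz) (Real.sqrt_nonneg s)).trans ?_
  rcases le_total 0 s with hs | hs
  · refine le_of_sq_le_sq ?_ dist_nonneg
    rw [mul_pow, Real.sq_sqrt hs]
    exact h z hz
  · rw [Real.sqrt_eq_zero_of_nonpos hs, zero_mul]
    exact dist_nonneg

theorem isLocalMinOn_of_infDist_lt {T : Set X} {f : X → ℝ} (hx : Metric.infDist x S < δ)
    (h : ∀ z ∈ T, Metric.infDist z S ≤ δ → f x ≤ f z) : IsLocalMinOn f T x := by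
  have h1 : ∀ᶠ z in nhds x, Metric.infDist z S < δ :=
    (Metric.continuous_infDist_pt S).continuousAt.eventually_lt continuousAt_const hx
  filter_upwards [nhdsWithin_le_nhds h1, self_mem_nhdsWithin] with z hz hzT
  exact h z hzT hz.le

theorem exists_tendsto_of_dist_le [CompleteSpace X] {x : ℕ → X} {b : ℕ → ℝ} {c : ℝ} (hc : 0 ≤ c)
    (hb : ∀ k, 0 ≤ b k) (h : ∀ k, dist (x k) (x (k + 1)) ≤ c * (b k - b (k + 1))) :
    ∃ p, Filter.Tendsto x Filter.atTop (nhds p) ∧ ∀ k, dist (x k) p ≤ c * b k := by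
  have hmono : ∀ i m, dist (x i) (x (i + m)) ≤ c * (b i - b (i + m)) := by
    intro i m
    induction m with
    | zero => simp
    | succ m ih =>
      have := dist_triangle (x i) (x (i + m)) (x (i + m + 1))
      have := h (i + m)
      rw [← add_assoc]
      linarith
  have hsum : Summable fun k => dist (x k) (x k.succ) := by
    refine summable_of_sum_range_le (c := c * b 0) (fun _ => dist_nonneg) fun n => ?_
    refine (Finset.sum_le_sum fun i _ => h i).trans ?_
    rw [← Finset.mul_sum, Finset.sum_range_sub']
    have := hb n
    gcongr
    linarith
  obtain ⟨p, hp⟩ := cauchySeq_tendsto_of_complete (cauchySeq_of_summable_dist hsum)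
  refine ⟨p, hp, fun k => ?_⟩
  have h1 : Filter.Tendsto (fun m => dist (x k) (x (k + m))) Filter.atTop (nhds (dist (x k) p)) := by
    refine tendsto_const_nhds.dist ((hp.comp (Filter.tendsto_add_atTop_nat k)).congr fun m => ?_)
    rw [Function.comp_apply, add_comm]
  refine le_of_tendsto' h1 fun m => (hmono k m).trans ?_
  have := hb (k + m)
  gcongr
  linarith

end MetricLemmas

/-! ### Step lengths and geometric decay from scalar recursions. -/

section Scalar

theorem step_length_le {t ρ μ' κ w u u' : ℝ} (ht : 0 ≤ t) (hρ : 0 < ρ) (hμ' : 0 < μ')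
    (hκ : 0 ≤ κ) (hw : 0 ≤ w) (hu' : 0 ≤ u') (hd : u' ≤ u - t * ρ / 2 * w ^ 2)
    (hPL : μ' * u ≤ κ ^ 2 * w ^ 2) : t * w ≤ κ * (4 / (ρ * √μ')) * (√u - √u') := by
  have hm : 0 < √μ' := Real.sqrt_pos.2 hμ'
  have hdd : 0 ≤ t * ρ / 2 * w ^ 2 := by positivity
  have hu : 0 ≤ u := by linarith
  have hab : √u' ≤ √u := Real.sqrt_le_sqrt (by linarith)
  have hma : √μ' * √u ≤ κ * w := by
    rw [← Real.sqrt_mul hμ'.le]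
    refine Real.sqrt_le_iff.2 ⟨by positivity, ?_⟩
    rwa [mul_pow]
  suffices h : t * w * (ρ * √μ') ≤ 4 * κ * (√u - √u') by
    rw [mul_div_assoc', div_mul_eq_mul_div, le_div_iff₀ (by positivity)]
    linarith
  have ea : √u ^ 2 = u := Real.sq_sqrt hu
  have eb : √u' ^ 2 = u' := Real.sq_sqrt hu'
  have hb0 := Real.sqrt_nonneg u'
  -- If `u = 0`, the descent inequality forces `t w = 0`. Otherwise `u - u' ≤ 2√u (√u - √u')`, and
  -- `√u` is bounded through `κ w`.
  rcases (Real.sqrt_nonneg u).eq_or_lt with h0 | h0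
  · have hu0 : u = 0 := by rw [← ea, ← h0]; ring
    have h1 : t * ρ / 2 * w ^ 2 = 0 := by linarith
    have h2 : t * w = 0 := by
      rcases mul_eq_zero.1 h1 with h | h
      · have : t = 0 := by
          rcases mul_eq_zero.1 (by linarith : t * ρ = 0) with h | h
          · exact h
          · exact absurd h hρ.ne'
        rw [this, zero_mul]
      · rw [pow_eq_zero_iff two_ne_zero |>.1 h, mul_zero]
    rw [h2, zero_mul]
    exact mul_nonneg (by positivity) (by linarith)
  · refine le_of_mul_le_mul_right ?_ h0
    have h1 := mul_le_mul_of_nonneg_left hma (by positivity : 0 ≤ t * w * ρ)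
    have h2 : κ * (t * ρ / 2 * w ^ 2) ≤ κ * ((√u - √u') * (√u + √u')) := by
      refine mul_le_mul_of_nonneg_left ?_ hκ
      have : (√u - √u') * (√u + √u') = u - u' := by rw [← ea, ← eb]; simp only [ea, eb]; linarith
      linarith
    have h3 : κ * ((√u - √u') * (√u + √u')) ≤ κ * ((√u - √u') * (2 * √u)) := by
      refine mul_le_mul_of_nonneg_left (mul_le_mul_of_nonneg_left ?_ ?_) hκ <;> linarith
    linarith

theorem mul_sqrt_le_of_le_sq {ρ μ' δ u : ℝ} (hρ : 0 < ρ) (hμ' : 0 < μ') (hδ : 0 ≤ δ)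
    (hu : u ≤ μ' * ρ ^ 2 * δ ^ 2 / 16) : 4 / (ρ * √μ') * √u ≤ δ := by
  have hm : 0 < √μ' := Real.sqrt_pos.2 hμ'
  have h1 : √u ≤ √μ' * ρ * δ / 4 := by
    refine Real.sqrt_le_iff.2 ⟨by positivity, hu.trans_eq ?_⟩
    rw [div_pow, mul_pow, mul_pow, Real.sq_sqrt hμ'.le]
    norm_num
  rw [div_mul_eq_mul_div, div_le_iff₀ (by positivity)]
  linarith

/-- The contraction is needed only while `u k ≥ 0`: afterwards `u` stays at or below a negative
value while the bound is nonnegative. If `u` starts negative, `q ^ k ≤ 1` suffices. -/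
theorem le_geometric_of_contraction {u : ℕ → ℝ} {q : ℝ} (hq : q ≤ 1) (hq0 : 0 ≤ q ∨ u 0 = 0)
    (hanti : Antitone u) (hc : ∀ k, 0 ≤ u k → u (k + 1) ≤ q * u k) (k : ℕ) :
    u k ≤ q ^ k * u 0 := by
  rcases hq0 with hq0 | h0
  · rcases le_or_gt 0 (u 0) with h0 | h0
    · induction k with
      | zero => simp
      | succ k ih =>
        rcases le_or_gt 0 (u k) with h | h
        · rw [pow_succ']
          linarith [hc k h, mul_le_mul_of_nonneg_left ih hq0]
        · exact ((hanti k.le_succ).trans h.le).trans (by positivity)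
    · refine (hanti k.zero_le).trans ?_
      have := pow_le_one₀ hq0 hq (n := k)
      nlinarith
  · rw [h0, mul_zero, ← h0]
    exact hanti k.zero_le

end Scalar

/-! ### Staying close to the minima. -/

section Tracking

variable {d r : ℕ} {f : Matrix (Fin d) (Fin r) ℝ → ℝ} {L : ℝ≥0} {γ lam ε : ℝ}

theorem infDist_lt_of_le_pathFactor {S : Set (Matrix (Fin d) (Fin r) ℝ)} {δ n : ℝ} (hδ : 0 < δ)
    (hn : n ≤ 3 / 4) {p : Matrix (Fin d) (Fin r) ℝ}
    (h : Metric.infDist p S ≤ (1 + pathFactor n) * δ) :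
    Metric.infDist p S < √√(1 - n) * (2 * δ) := by
  have h1 := one_add_pathFactor_sq_lt hn
  have h2 : (1 + pathFactor n) / 2 < √√(1 - n) := by
    refine Real.lt_sqrt_of_sq_lt ?_
    rw [div_pow]
    linarith
  refine h.trans_lt ?_
  nlinarith

theorem mem_cthickening_of_infDist_lt {S : Set (Matrix (Fin d) (Fin r) ℝ)} {δ n : ℝ}
    (hS : S.Nonempty) (hSS : S ⊆ stiefel d r) (hδ : 0 < δ) (hn : n < 1)
    {p y : Matrix (Fin d) (Fin r) ℝ}
    (hy : ∀ z ∈ stiefel d r, √(1 - n) * ‖y - z‖ ^ 2 ≤ ‖p - z‖ ^ 2)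
    (h : Metric.infDist p S < √√(1 - n) * (2 * δ)) : y ∈ Metric.cthickening (2 * δ) S := by
  rw [mem_cthickening_iff_infDist_le hS (by positivity)]
  have h1 : √√(1 - n) * Metric.infDist y S ≤ Metric.infDist p S :=
    sqrt_mul_infDist_le hS fun z hz => by
      rw [dist_eq_norm, dist_eq_norm]
      exact hy z (hSS hz)
  have h2 : 0 < √√(1 - n) := Real.sqrt_pos.2 (Real.sqrt_pos.2 (by linarith))
  exact le_of_mul_le_mul_left (h1.trans h.le) h2

theorem continuous_norm_gram_sub_one :
    Continuous (fun x : Matrix (Fin d) (Fin r) ℝ => ‖xᵀ * x - 1‖) :=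
  differentiable_gram_sub_one.continuous.norm

theorem pathFactor_anti {n n' : ℝ} (h : max n (1 / 4) ≤ max n' (1 / 4)) :
    pathFactor n' ≤ pathFactor n := by
  rw [pathFactor, pathFactor]
  linarith

/-- The contraction rate is at most `1` unless the zero matrix lies on the Stiefel manifold. -/
theorem rate_le_one_or_eq_zero {K : ℝ≥0} {μ Lh Lp ρ α : ℝ} (hε : 0 < ε) (hε' : ε < 3 / 4)
    (hlam : 0 < lam) (hμ : 0 < μ)
    (hK : LipschitzOnWith K (landingField f lam) (safeRegion d r ε)) (hKL : (K : ℝ) ≤ Lp)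
    (hρ : 0 < ρ) (hρ' : ρ ≤ 1 / 2) (hα : 0 < α) (hα' : 2 * α * lam ≤ 1)
    {z : Matrix (Fin d) (Fin r) ℝ} (hz : z ∈ stiefel d r) :
    α * ρ * muPrime μ lam ε Lh Lp / 2 ≤ 1 ∨ z = 0 := by
  rcases eq_or_ne z 0 with h0 | h0
  · exact Or.inr h0
  · left
    have h1 := (two_mul_le_of_lipschitzOn hε hlam hK hz h0).trans hKL
    have h2 := muPrime_mul_le (lam := lam) (ε := ε) (Lh := Lh) (Lp := Lp) hμ hlam (by linarith)
    have hm : 0 < muPrime μ lam ε Lh Lp := muPrime_pos hμ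
    generalize muPrime μ lam ε Lh Lp = m at h2 hm ⊢
    have h3 : m * Lp ≤ 2 * lam ^ 2 := by
      refine le_of_mul_le_mul_left ?_ hμ
      have h4 : 0 ≤ m * (2 * (3 + 2 * ε) ^ 2 * Lh ^ 2) := by positivity
      have h5 : (1 - ε) ^ 2 ≤ 1 := by nlinarith
      have h6 := mul_le_mul_of_nonneg_left h5 (by positivity : 0 ≤ 2 * μ * lam ^ 2)
      linarith
    -- The Lipschitz bound gives `Lp ≥ 2 lam`, and `m Lp ≤ 2 lam²` then leaves `m ≤ lam`.
    have h4 : m ≤ lam := by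
      have := mul_le_mul_of_nonneg_left h1 hm.le
      nlinarith
    have h5 : α * ρ * m ≤ α * (1 / 2) * lam := by gcongr
    linarith

end Tracking

end Landing

/-! ### Assembly of the main theorem. -/

theorem theorem1 {d r : ℕ} (f : Matrix (Fin d) (Fin r) ℝ → ℝ)
    (L : ℝ≥0) (hf : IsSmoothObjective f L)
    (fS μ δ : ℝ) (hμ : 0 < μ) (hδ : 0 < δ) (hPL : LocalRiemannianPL f fS μ δ)
    (ε lam : ℝ) (hε : 0 < ε) (hε' : ε < 3 / 4) (hlam : 0 < lam)
    (γ : ℝ) (hγ : gammaMin f L ε lam ≤ γ)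
    -- a Lipschitz constant of the landing field and a smoothness constant of the merit function
    (LΛ : ℝ≥0) (hLΛ : LipschitzOnWith LΛ (landingField f lam) (safeRegion d r ε))
    (LM : ℝ) (hLM : SmoothOn (merit f γ) LM (safeRegion d r ε))
    (Lp ρ μ' : ℝ) (hLp : Lp = max (Lhat f L ε) (max (LΛ : ℝ) LM))
    (hρ : ρ = rho γ lam ε) (hμ' : μ' = muPrime μ lam ε (Lhat f L ε) Lp)
    (α : ℝ) (x : ℕ → Matrix (Fin d) (Fin r) ℝ) (hx : IsLandingSequence f lam α x)
    (G : ℝ) (hG : 0 < G) (hxG : ∀ k, x k ∈ safeRegion d r ε → ‖relGrad f (x k)‖ ≤ G)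
    (hα : 0 < α) (hα' : α ≤ min (ρ / Lp) (alphaSafe lam ε G))
    (hx₀ : x 0 ∈ Metric.cthickening δ (localMinima f fS) ∩ safeRegion d r ε)
    (hx₀' : merit f γ (x 0) - fS ≤ μ' * ρ ^ 2 * δ ^ 2 / 16) :
    (∀ k, x k ∈ safeRegion d r ε ∧
      merit f γ (x k) - fS ≤ (1 - α * ρ * μ' / 2) ^ k * (merit f γ (x 0) - fS)) ∧
    ((∀ y ∈ stiefel d r ∩ Metric.cthickening (2 * δ) (localMinima f fS), fS ≤ f y) →
      ∀ k, x k ∈ Metric.cthickening δ (localMinima f fS)) := by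
  obtain ⟨hx₀c, hx₀s⟩ := hx₀
  have hε1 : ε < 1 := by linarith
  have hLh0 : 0 ≤ Lhat f L ε := L.2.trans (le_Lhat (f := f))
  have hLΛp : (LΛ : ℝ) ≤ Lp := by rw [hLp]; exact le_max_of_le_right (le_max_left _ _)
  have hLMp : LM ≤ Lp := by rw [hLp]; exact le_max_of_le_right (le_max_right _ _)
  -- If `Lp` were zero, `ρ / Lp` would be `0` by convention, contradicting `0 < α`.
  have hLp0 : 0 < Lp := by
    refine (LΛ.2.trans hLΛp).lt_of_ne fun h => ?_
    have := hα'.trans (min_le_left _ _)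
    rw [← h, div_zero] at this
    linarith
  have hαL : α * Lp ≤ ρ := (le_div_iff₀ hLp0).1 (hα'.trans (min_le_left _ _))
  have hαs : α ≤ alphaSafe lam ε G := hα'.trans (min_le_right _ _)
  have hρ0 : 0 < ρ := lt_of_lt_of_le (by positivity) hαL
  have hρ2 : ρ ≤ 1 / 2 := by rw [hρ]; exact min_le_left _ _
  have hm0 : 0 < μ' := by rw [hμ']; exact muPrime_pos hμ
  obtain ⟨S, hS⟩ : ∃ S, S = localMinima f fS := ⟨_, rfl⟩
  have hSS : S ⊆ stiefel d r := fun z hz => by rw [hS] at hz; exact hz.1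
  have hSne : S.Nonempty := by
    rw [Set.nonempty_iff_ne_empty, hS]
    intro h
    rw [h, Metric.cthickening_empty] at hx₀c
    exact hx₀c
  rw [← hS, mem_cthickening_iff_infDist_le hSne hδ.le] at hx₀c
  rw [← hS]
  obtain ⟨u, hu⟩ : ∃ u : Matrix (Fin d) (Fin r) ℝ → ℝ, ∀ p, u p = merit f γ p - fS :=
    ⟨_, fun _ => rfl⟩
  have hucont : Continuous u := by
    rw [funext hu]
    exact hf.differentiable_merit.continuous.sub continuous_const
  -- the Łojasiewicz inequality for the merit function
  have hPLm : ∀ p ∈ safeRegion d r ε,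
      Metric.infDist p S < √√(1 - ‖pᵀ * p - 1‖) * (2 * δ) →
      μ' * u p ≤ pathFactor ‖pᵀ * p - 1‖ ^ 2 * ‖landingField f lam p‖ ^ 2 ∧
      ((∀ y ∈ stiefel d r ∩ Metric.cthickening (2 * δ) S, fS ≤ f y) → 0 ≤ u p) := by
    intro p hp hpS
    obtain ⟨y, hy, hyz, hyM, hyg, hyf⟩ :=
      exists_stiefel_comparison hf hε' hlam hγ hLM hLMp hLp0.le hp
    have hyS := mem_cthickening_of_infDist_lt hSne hSS hδ (lt_of_le_of_lt hp hε1) hyz hpS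
    refine ⟨?_, fun h => ?_⟩
    · rw [hμ', hu]
      exact muPrime_mul_merit_le hf hε' hlam hμ hPL hLp0.le hp ⟨hy, by rwa [hS] at hyS⟩ hyM hyg
    · rw [hu]
      linarith [h y ⟨hy, hyS⟩]
  have hdesc : ∀ p ∈ safeRegion d r ε, ‖relGrad f p‖ ≤ G → ∀ t, 0 ≤ t → t ≤ α →
      u (p - t • landingField f lam p) ≤ u p - t * ρ / 2 * ‖landingField f lam p‖ ^ 2 := by
    intro p hp hpG t ht htα
    have := merit_landing_step_le hf hε hε' hlam hγ hLM hLMp ht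
      (by rw [← hρ]; exact (mul_le_mul_of_nonneg_right htα hLp0.le).trans hαL)
      (by rw [← hρ]; exact hρ0.le) hG (htα.trans hαs) hpG hp
    rw [← hρ] at this
    rw [hu, hu]
    linarith
  have hsafe : ∀ k, x k ∈ safeRegion d r ε := by
    intro k
    induction k with
    | zero => exact hx₀s
    | succ k ih =>
      rw [hx k]
      exact landing_step_mem_safeRegion hlam hα.le hε hε' hG hαs (hxG k ih) ih
  have hxGk : ∀ k, ‖relGrad f (x k)‖ ≤ G := fun k => hxG k (hsafe k)
  have huk : ∀ k, u (x (k + 1)) ≤ u (x k) - α * ρ / 2 * ‖landingField f lam (x k)‖ ^ 2 := by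
    intro k
    rw [hx k]
    exact hdesc _ (hsafe k) (hxGk k) α hα.le le_rfl
  have huanti : Antitone fun k => u (x k) := antitone_nat_of_succ_le fun k =>
    (huk k).trans (sub_le_self _ (by positivity))
  have hδ0 : 4 / (ρ * √μ') * √(u (x 0)) ≤ δ :=
    mul_sqrt_le_of_le_sq hρ0 hm0 hδ.le (by rw [hu]; exact hx₀')
  -- points whose distance to the initial point is controlled by the decrease of the merit function
  obtain ⟨Tr, hTr⟩ : ∃ Tr : Matrix (Fin d) (Fin r) ℝ → Prop, ∀ p, Tr p ↔
      p ∈ safeRegion d r ε ∧ 0 ≤ u p ∧ dist (x 0) p ≤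
        pathFactor ‖pᵀ * p - 1‖ * (4 / (ρ * √μ')) * (√(u (x 0)) - √(u p)) := ⟨_, fun _ => Iff.rfl⟩
  have hTrclose : ∀ p, Tr p → Metric.infDist p S < √√(1 - ‖pᵀ * p - 1‖) * (2 * δ) := by
    intro p hp
    obtain ⟨hps, hup, hpd⟩ := (hTr p).1 hp
    have hn : ‖pᵀ * p - 1‖ ≤ 3 / 4 := le_trans hps hε'.le
    refine infDist_lt_of_le_pathFactor hδ hn ?_
    have h1 : Metric.infDist p S ≤ Metric.infDist (x 0) S + dist p (x 0) :=
      Metric.infDist_le_infDist_add_dist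
    have hκ := pathFactor_pos hn
    have h2 : 0 ≤ pathFactor ‖pᵀ * p - 1‖ * (4 / (ρ * √μ')) * √(u p) := by positivity
    have h3 := mul_le_mul_of_nonneg_left hδ0 hκ.le
    rw [dist_comm] at h1
    linarith
  -- The step can only raise `pathFactor`, so the length bound inherited from `p` remains valid with
  -- the new factor and adds up with the length of the step.
  have hTrstep : ∀ p, Tr p → ‖relGrad f p‖ ≤ G → ∀ t, 0 ≤ t → t ≤ α →
      0 ≤ u (p - t • landingField f lam p) → Tr (p - t • landingField f lam p) := by
    intro p hp hpG t ht htα hut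
    obtain ⟨hps, hup, hpd⟩ := (hTr p).1 hp
    have hn : ‖pᵀ * p - 1‖ ≤ 3 / 4 := le_trans hps hε'.le
    have hmax := max_norm_gram_landing_step_le hlam ht hε hε' hG (htα.trans hαs) hpG hps
    have hd := hdesc p hps hpG t ht htα
    have hlen := step_length_le ht hρ0 hm0 (pathFactor_pos hn).le (norm_nonneg _) hut hd
      (hPLm p hps (hTrclose p hp)).1
    refine (hTr _).2 ⟨landing_step_mem_safeRegion hlam ht hε hε' hG (htα.trans hαs) hpG hps,
      hut, ?_⟩
    have hdist : dist p (p - t • landingField f lam p) = t * ‖landingField f lam p‖ := by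
      rw [dist_eq_norm, sub_sub_cancel, norm_smul, Real.norm_of_nonneg ht]
    have hK : 0 ≤ 4 / (ρ * √μ') := by positivity
    have h0 : 0 ≤ √(u (x 0)) - √(u (p - t • landingField f lam p)) := by
      by_contra hneg
      push Not at hneg
      have h5 : √(u (p - t • landingField f lam p)) ≤ √(u p) :=
        Real.sqrt_le_sqrt (hd.trans (sub_le_self _ (by positivity)))
      have h6 : 0 < pathFactor ‖pᵀ * p - 1‖ * (4 / (ρ * √μ')) := by
        have := pathFactor_pos hn
        positivity
      have h7 : 0 ≤ √(u (x 0)) - √(u p) :=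
        (mul_nonneg_iff_of_pos_left h6).1 (dist_nonneg.trans hpd)
      linarith
    have h1 := dist_triangle (x 0) p (p - t • landingField f lam p)
    rw [hdist] at h1
    have h2 := mul_le_mul_of_nonneg_right (mul_le_mul_of_nonneg_right (pathFactor_anti hmax) hK) h0
    linarith
  have hTr0 : 0 ≤ u (x 0) → Tr (x 0) := fun h => (hTr _).2 ⟨hx₀s, h, by simp⟩
  -- Since `u` decreases along the iterates, nonnegativity at one of them passes back to all earlier
  -- ones; no lower bound on `f` enters here.
  have hTrk : ∀ k, 0 ≤ u (x k) → Tr (x k) := by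
    intro k
    induction k with
    | zero => exact hTr0
    | succ k ih =>
      intro h
      have hk : Tr (x k) := ih (h.trans (huanti k.le_succ))
      rw [hx k] at h ⊢
      exact hTrstep _ hk (hxGk k) α hα.le le_rfl h
  have hκ1 : ∀ k, pathFactor ‖(x k)ᵀ * x k - 1‖ ^ 2 ≤ 1 := fun k => by
    have h1 := pathFactor_pos (le_trans (hsafe k) hε'.le)
    have h2 := pathFactor_le ‖(x k)ᵀ * x k - 1‖
    nlinarith
  have hPLk : ∀ k, 0 ≤ u (x k) → μ' * u (x k) ≤ ‖landingField f lam (x k)‖ ^ 2 := fun k hk =>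
    (hPLm _ (hsafe k) (hTrclose _ (hTrk k hk))).1.trans
      (mul_le_of_le_one_left (sq_nonneg _) (hκ1 k))
  have hcontr : ∀ k, 0 ≤ u (x k) → u (x (k + 1)) ≤ (1 - α * ρ * μ' / 2) * u (x k) := by
    intro k hk
    have h1 := mul_le_mul_of_nonneg_left (hPLk k hk) (by positivity : 0 ≤ α * ρ / 2)
    linarith [huk k]
  refine ⟨fun k => ⟨hsafe k, ?_⟩, fun hfS => ?_⟩
  · rw [← hu, ← hu]
    refine le_geometric_of_contraction (u := fun k => u (x k)) (sub_le_self _ (by positivity)) ?_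
      huanti hcontr k
    obtain ⟨z, hz⟩ := hSne
    rcases rate_le_one_or_eq_zero (Lh := Lhat f L ε) hε hε' hlam hμ hLΛ hLΛp hρ0 hρ2 hα
      (alphaSafe_bounds hlam hε hG hαs).1 (hSS hz) with h | h
    · rw [← hμ'] at h
      exact Or.inl (by linarith)
    -- The zero matrix is on the Stiefel manifold only if the identity is zero; then the matrix
    -- space is a single point, where `u` vanishes.
    · right
      have hz1 : zᵀ * z = 1 := hSS hz
      have h0 : ∀ p : Matrix (Fin d) (Fin r) ℝ, p = z := fun p => by
        rw [← Matrix.mul_one p, ← hz1, h]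
        simp
      change u (x 0) = 0
      rw [hS] at hz
      rw [h0 (x 0), hu, merit_of_stiefel hz1, hz.2.2, sub_self]
  · have hstart : 0 ≤ u (x 0) := by
      have hn : ‖(x 0)ᵀ * x 0 - 1‖ ≤ 3 / 4 := le_trans hx₀s hε'.le
      refine (hPLm _ hx₀s (infDist_lt_of_le_pathFactor hδ hn (hx₀c.trans ?_))).2 hfS
      have := mul_pos (pathFactor_pos hn) hδ
      linarith
    have hTrnext : ∀ p, Tr p → ‖relGrad f p‖ ≤ G → Tr (p - α • landingField f lam p) := by
      intro p hp hpG
      have hc : Continuous fun t : ℝ => p - t • landingField f lam p := by fun_prop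
      -- Continuous induction on the step size. Where `u ≥ 0`, the tracking bound gives closeness
      -- with strict inequality; closeness persists slightly beyond and there forces `u ≥ 0` again.
      have hsub : Set.Icc 0 α ⊆ {t | 0 ≤ u (p - t • landingField f lam p)} := by
        refine IsClosed.Icc_subset_of_forall_exists_gt
          ((isClosed_le continuous_const (hucont.comp hc)).inter isClosed_Icc) ?_ ?_
        · simpa using ((hTr p).1 hp).2.1
        · rintro t ⟨ht, ht0, htα⟩ b hb
          have hclose := hTrclose _ (hTrstep p hp hpG t ht0 htα.le ht)
          have hev : ∀ᶠ s in nhds t, Metric.infDist (p - s • landingField f lam p) S <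
              √√(1 - ‖(p - s • landingField f lam p)ᵀ * (p - s • landingField f lam p) - 1‖)
                * (2 * δ) := by
            refine ContinuousAt.eventually_lt
              ((Metric.continuous_infDist_pt S).comp hc).continuousAt ?_ hclose
            exact ((Real.continuous_sqrt.comp (Real.continuous_sqrt.comp (continuous_const.sub
              (continuous_norm_gram_sub_one.comp hc)))).mul continuous_const).continuousAt
          obtain ⟨s, hs, hsb⟩ := ((hev.filter_mono nhdsWithin_le_nhds).and
            (Ioc_mem_nhdsGT (lt_min hb htα))).exists
          refine ⟨s, (hPLm _ ?_ hs).2 hfS, hsb.1, hsb.2.trans (min_le_left _ _)⟩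
          exact landing_step_mem_safeRegion hlam (ht0.trans hsb.1.le) hε hε' hG
            ((hsb.2.trans (min_le_right _ _)).trans hαs) hpG ((hTr p).1 hp).1
      exact hTrstep p hp hpG α hα.le le_rfl (hsub ⟨hα.le, le_rfl⟩)
    have hall : ∀ k, Tr (x k) := by
      intro k
      induction k with
      | zero => exact hTr0 hstart
      | succ k ih =>
        rw [hx k]
        exact hTrnext _ ih (hxGk k)
    have hu0 : ∀ k, 0 ≤ u (x k) := fun k => ((hTr _).1 (hall k)).2.1
    have hK : 0 ≤ 4 / (ρ * √μ') := by positivity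
    have hdist : ∀ k, dist (x k) (x (k + 1)) = α * ‖landingField f lam (x k)‖ := fun k => by
      rw [hx k, dist_eq_norm, sub_sub_cancel, norm_smul, Real.norm_of_nonneg hα.le]
    -- The constant `67/80` is the largest value of `pathFactor`, so the tail length is at most
    -- `67/80 · δ`.
    obtain ⟨p, hp, hpd⟩ := exists_tendsto_of_dist_le (x := x) (b := fun k => √(u (x k)))
      (c := 67 / 80 * (4 / (ρ * √μ'))) (by positivity) (fun k => Real.sqrt_nonneg _) (fun k => by
        rw [hdist]
        have hn : ‖(x k)ᵀ * x k - 1‖ ≤ 3 / 4 := le_trans (hsafe k) hε'.le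
        refine (step_length_le hα.le hρ0 hm0 (pathFactor_pos hn).le (norm_nonneg _) (hu0 (k + 1))
          (huk k) (hPLm _ (hsafe k) (hTrclose _ (hall k))).1).trans ?_
        have h1 : 0 ≤ √(u (x k)) - √(u (x (k + 1))) :=
          sub_nonneg.2 (Real.sqrt_le_sqrt (huanti k.le_succ))
        exact mul_le_mul_of_nonneg_right (mul_le_mul_of_nonneg_right (pathFactor_le _) hK) h1)
    have hpδ : ∀ k, dist (x k) p ≤ 67 / 80 * δ := by
      intro k
      have h1 : √(u (x k)) ≤ √(u (x 0)) := Real.sqrt_le_sqrt (huanti k.zero_le)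
      have h2 := (mul_le_mul_of_nonneg_left h1 hK).trans hδ0
      refine (hpd k).trans ?_
      rw [mul_assoc]
      linarith
    have hps : p ∈ safeRegion d r ε :=
      (isClosed_le continuous_norm_gram_sub_one continuous_const).mem_of_tendsto hp
        (Filter.Eventually.of_forall hsafe)
    have hΛ0 : Filter.Tendsto (fun k => ‖landingField f lam (x k)‖) Filter.atTop (nhds 0) := by
      have h1 : Filter.Tendsto (fun k => dist (x k) (x (k + 1))) Filter.atTop (nhds (dist p p)) :=
        hp.dist (hp.comp (Filter.tendsto_add_atTop_nat 1))
      rw [dist_self] at h1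
      have h2 := h1.const_mul α⁻¹
      rw [mul_zero] at h2
      refine h2.congr fun k => ?_
      rw [hdist, inv_mul_cancel_left₀ hα.ne']
    have hΛp : ‖landingField f lam p‖ = 0 := by
      have h1 : Filter.Tendsto x Filter.atTop (nhdsWithin p (safeRegion d r ε)) :=
        tendsto_nhdsWithin_iff.2 ⟨hp, Filter.Eventually.of_forall hsafe⟩
      exact tendsto_nhds_unique ((hLΛ.continuousOn p hps).tendsto.comp h1).norm hΛ0
    have hpSt : pᵀ * p = 1 := by
      have h1 := norm_landingField_sq (f := f) (lam := lam) p
      rw [hΛp] at h1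
      have h2 : ‖p * (pᵀ * p - 1)‖ ^ 2 = 0 := by
        by_contra hne
        have h3 : 0 < ‖p * (pᵀ * p - 1)‖ ^ 2 := (sq_nonneg _).lt_of_ne' hne
        have h4 : 0 < lam ^ 2 * ‖p * (pᵀ * p - 1)‖ ^ 2 := by positivity
        have h5 := sq_nonneg ‖relGrad f p‖
        linarith
      have h3 := le_norm_mul_sq p hps (pᵀ * p - 1)
      rw [h2] at h3
      have h4 : ‖pᵀ * p - 1‖ ^ 2 ≤ 0 := by
        by_contra hne
        push Not at hne
        have := mul_pos (by linarith : 0 < 1 - ε) hne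
        linarith
      have h5 : ‖pᵀ * p - 1‖ = 0 := pow_eq_zero_iff two_ne_zero |>.1 (le_antisymm h4 (sq_nonneg _))
      exact sub_eq_zero.1 (norm_eq_zero.1 h5)
    have hup : u p = 0 := by
      have h1 : Filter.Tendsto (fun k => u (x k)) Filter.atTop (nhds (u p)) :=
        (hucont.tendsto p).comp hp
      have h2 : Filter.Tendsto (fun k => u (x k)) Filter.atTop (nhds 0) := by
        have h3 := (hΛ0.pow 2).const_mul μ'⁻¹
        rw [zero_pow two_ne_zero, mul_zero] at h3
        refine squeeze_zero hu0 (fun k => ?_) h3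
        rw [inv_mul_eq_div, le_div_iff₀ hm0, mul_comm]
        exact hPLk k (hu0 k)
      exact tendsto_nhds_unique h1 h2
    have hfp : f p = fS := by
      rw [hu, merit_of_stiefel hpSt] at hup
      linarith
    -- The limit is a Stiefel point of value `fS` strictly within `2δ` of `S`, so `f ≥ fS` at all
    -- nearby Stiefel points makes it a local minimum.
    have hpS : p ∈ S := by
      have h1 : Metric.infDist p S < 2 * δ := by
        have h2 : Metric.infDist p S ≤ Metric.infDist (x 0) S + dist p (x 0) :=
          Metric.infDist_le_infDist_add_dist
        rw [dist_comm] at h2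
        linarith [hpδ 0]
      rw [hS]
      refine ⟨hpSt, ?_, hfp⟩
      refine isLocalMinOn_of_infDist_lt h1 fun z hz hzS => ?_
      rw [hfp]
      exact hfS z ⟨hz, (mem_cthickening_iff_infDist_le hSne (by positivity)).2 hzS⟩
    intro k
    rw [mem_cthickening_iff_infDist_le hSne hδ.le]
    refine (Metric.infDist_le_dist_of_mem hpS).trans ((hpδ k).trans ?_)
    linarith
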